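/- For a finite group $G$ the integer group determinants of $G$ are the values of $\det\big(x_{gh^{-1}}\big)_{g,h\in G}$ with all $x_g\in\mathbb Z$. Let $p$ be an odd prime and let $Q_{4p}=\langle x,y : x^{2p}=1,\ y^2=x^p,\ xy=yx^{-1}\rangle$ be the dicyclic group of order $4p$. Below, $m$ denotes an integer with $\gcd(m,2p)=1$, and "determinant" means an integer group determinant of $Q_{4p}$. 1. Every nonzero determinant has the form $2^kp^{\ell}m$ with $\gcd(m,2p)=1$, where $k=0$ or $k\ge 4$, and $\ell=0$ or $\ell\ge 3$. 2. Every integer $2^kp^{\ell}m$ with $\gcd(m,2p)=1$, with $k=0$, $k=4$ or $k\ge 6$, and with $\ell=0$ or $\ell\ge 3$, is a determinant. Every integer $2^5p^{\ell}m$ with $\gcd(m,2p)=1$ and with $\ell=4$ or $\ell\ge 6$ is a determinant. 3. Not every $2^5m$ with $\gcd(m,2p)=1$ is a determinant. The smallest $|m|$ with $\gcd(m,2p)=1$ for which $2^5m$ is a determinant is $\frac12(p^2+1)$, and $2^5\cdot\frac12(p^2+1)$ itself is a determinant. 4. If $p\equiv 3 \bmod 4$, then for $\ell=3$ and for $\ell=5$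 the smallest $|m|$ with $\gcd(m,2p)=1$ for which $2^5p^{\ell}m$ is a determinant is $\frac12(p^2+1)$, and $2^5p^{\ell}\cdot\frac12(p^2+1)$ itself is a determinant. 5. If $p\equiv 1\bmod 4$, then every integer multiple of $2^5p^5$ is a determinant. If $p=5$, then every integer multiple of $2^5p^3$ is a determinant. -/

import Mathlib

/-- The group determinant of `G` at the integers `x g`: the determinant of the matrix, with rows and
columns indexed by `G`, whose `(g, h)` entry is `x (g * h⁻¹)`. -/
def groupDeterminant (G : Type*) [Group G] [Fintype G] [DecidableEq G] (x : G → ℤ) : ℤ :=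
  (Matrix.of fun g h : G => x (g * h⁻¹)).det

/-- The set of all values of the group determinant of `G` at integer arguments. -/
def integerGroupDeterminants (G : Type*) [Group G] [Fintype G] [DecidableEq G] : Set ℤ :=
  Set.range (groupDeterminant G)

/-- The set of the integer group determinants of the dicyclic group of order `4 * n`,
`⟨x, y : x ^ (2 * n) = 1, y ^ 2 = x ^ n, x * y = y * x⁻¹⟩`, which is `QuaternionGroup n`. -/
def dicyclicDeterminants (n : ℕ) [NeZero n] : Set ℤ :=
  integerGroupDeterminants (QuaternionGroup n)

/-- The set of the absolute values `|m|` of the integers `m` coprime to `2 * p` for which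
`2 ^ 5 * p ^ l * m` is an integer group determinant of the dicyclic group of order `4 * p`. -/
def cofactorAbsValues (p l : ℕ) [NeZero p] : Set ℕ :=
  {a | ∃ m : ℤ, Int.gcd m (2 * p) = 1 ∧ 2 ^ 5 * (p : ℤ) ^ l * m ∈ dicyclicDeterminants p ∧
    a = m.natAbs}

/-!
Let `C_p` be the cyclic group of order `p`. An element of the group ring of the dicyclic group is
a pair of elements of `ℤ[C_{2p}]`, and an element of `ℤ[C_{2p}]` is a pair `(f, f')` of elements
of `ℤ[C_p]` congruent modulo `2`. Diagonalizing the abelian part shows (`groupDeterminant_cast`,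
`mem_dicyclicDeterminants_iff`) that the determinants are the integers
`D = N(f f̄ - g ḡ) N(f' f̄' + g' ḡ')` with `f ≡ f'` and `g ≡ g'` modulo `2`, where the bar inverts group elements and `N` is
the product of the values at all characters of `C_p`. The trivial character contributes the
augmentation and the others the integer `cycNorm`, which for a symmetric element is the square of
an integer (`exists_cycNorm_eq_sq`). Hence `D = (a² - b²) A² (c² + e²) B²`, with `a ≡ c`, `b ≡ e`,
`A ≡ B` modulo `2`, and with `p ∣ A ↔ p ∣ a² - b²`, `p ∣ B ↔ p ∣ c² + e²`, because all the values
are congruent modulo the prime above `p` (`exists_factorization`).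

*Restrictions.* The shape of the nonzero determinants follows from these congruences. If `2 ^ 5`
exactly divides `D`, then `c² + e²` is, up to a factor `4`, a sum of two odd squares `r² + s²`,
and `(r² + s²) / 2 * B²` divides the cofactor. If `p` divides `r` or `s`, then `r² + s² ≥ p² + 1`.
Otherwise `f'` and `g'` have nonzero norms, and the inequality of arithmetic and geometric means
at each character gives `B² ≥ 2 ^ (p - 1)` (`two_pow_le_cycNorm`), which is large enough as well.
For `p ≡ 3` modulo `4` and exponents `3` and `5` of `p`, the prime `p` cannot divide `c² + e²`, so
that the same bound holds for the part of the cofactor prime to `p`.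

*Constructions.* If `P` and `Q` are symmetric with `(P - Q) / 2 = G + h + h̄` and `G` symmetric,
then `g = G + 2 h` and `f = P - g` satisfy `f f̄ - g ḡ = P Q` (`mem_of_symmetric`). There are
enough symmetric cyclotomic units: dividing the unit `(x ^ n - 1) / (x - 1)` into the one obtained
from it by replacing `x` by `-x` gives units congruent to `1` modulo `2` with any nonzero
augmentation modulo `p`, and adding multiples of the sum of `C_p` adjusts the augmentation
(`exists_unit_congr_one`, `exists_unit_aug_eq`). Choices of `P`, `Q`, `G`, `f'`, `g'` built from `1`, `x + x⁻¹`, `x - x⁻¹`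
and the sum of `C_p` yield all the required values, as the determinants are closed under
multiplication.
-/

open Matrix
open scoped AddMonoidAlgebra

/-! ### Group determinants and block matrices -/

/-- The group determinant is multiplicative for the convolution of functions on the group. -/
theorem groupDeterminant_mul (G : Type*) [Group G] [Fintype G] [DecidableEq G] (x y : G → ℤ) :
    groupDeterminant G x * groupDeterminant G y =
      groupDeterminant G fun g => ∑ h, x h * y (h⁻¹ * g) := by
  unfold groupDeterminant
  rw [← Matrix.det_mul]
  congr 1
  ext g h
  simp only [Matrix.mul_apply, Matrix.of_apply]
  refine Fintype.sum_equiv ((Equiv.inv G).trans (Equiv.mulLeft g)) _ _ fun k => ?_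
  simp [mul_assoc]

theorem mul_mem_dicyclicDeterminants {n : ℕ} [NeZero n] {a b : ℤ}
    (ha : a ∈ dicyclicDeterminants n) (hb : b ∈ dicyclicDeterminants n) :
    a * b ∈ dicyclicDeterminants n := by
  obtain ⟨x, rfl⟩ := ha
  obtain ⟨y, rfl⟩ := hb
  exact ⟨_, (groupDeterminant_mul _ x y).symm⟩

theorem det_fromBlocks_diagonal {O Q : Type*} [CommRing O] [Fintype Q] [DecidableEq Q]
    (a b c d : Q → O) :
    (fromBlocks (diagonal a) (diagonal b) (diagonal c) (diagonal d)).det =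
      ∏ k, (a k * d k - b k * c k) := by
  have h : fromBlocks (diagonal a) (diagonal b) (diagonal c) (diagonal d) =
      (blockDiagonal fun k => !![a k, b k; c k, d k]).submatrix
        (fun s : Q ⊕ Q => s.elim (fun k => ((0 : Fin 2), k)) (fun k => (1, k)))
        (fun s : Q ⊕ Q => s.elim (fun k => ((0 : Fin 2), k)) (fun k => (1, k))) := by
    ext (i | i) (j | j) <;> by_cases hij : i = j <;>
      simp [blockDiagonal_apply, hij]
  let e : Q ⊕ Q ≃ Fin 2 × Q :=
    { toFun := fun s => s.elim (fun k => (0, k)) (fun k => (1, k))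
      invFun := fun t => if t.1 = 0 then Sum.inl t.2 else Sum.inr t.2
      left_inv := by rintro (k | k) <;> simp
      right_inv := by rintro ⟨i, k⟩; fin_cases i <;> simp }
  rw [h]
  have := Matrix.det_submatrix_equiv_self e (blockDiagonal fun k => !![a k, b k; c k, d k])
  rw [show (fun s : Q ⊕ Q => s.elim (fun k => ((0 : Fin 2), k)) (fun k => (1, k))) = e from rfl,
    this, det_blockDiagonal]
  simp [det_fin_two]

/-- `Ω` plays the role of the character table of the finite abelian group `Q`: its columns are
characters, and it is invertible, so it diagonalizes all four blocks at once. -/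
theorem det_dicyclic_blocks {O Q : Type*} [CommRing O] [IsDomain O] [AddCommGroup Q] [Fintype Q]
    [DecidableEq Q] (Ω : Matrix Q Q O) (hΩ : Ω.det ≠ 0)
    (hadd : ∀ i j k, Ω (i + j) k = Ω i k * Ω j k) (ν : Q) (f g : Q → O) :
    (fromBlocks (of fun i j => f (i - j)) (of fun i j => g (ν + j - i))
        (of fun i j => g (i - j)) (of fun i j => f (j - i))).det =
      ∏ k, ((∑ i, f i * Ω i k) * (∑ i, f i * Ω (-i) k) -
        Ω (-ν) k * (∑ i, g i * Ω i k) * (∑ i, g i * Ω (-i) k)) := by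
  have key : fromBlocks (of fun i j => f (i - j)) (of fun i j => g (ν + j - i))
        (of fun i j => g (i - j)) (of fun i j => f (j - i)) * fromBlocks Ω 0 0 Ω =
      fromBlocks Ω 0 0 Ω * fromBlocks (diagonal fun k => ∑ i, f i * Ω (-i) k)
        (diagonal fun k => Ω (-ν) k * ∑ i, g i * Ω i k)
        (diagonal fun k => ∑ i, g i * Ω (-i) k) (diagonal fun k => ∑ i, f i * Ω i k) := by
    rw [fromBlocks_multiply, fromBlocks_multiply]
    congr 1
    · ext i k
      simp only [Matrix.add_apply, Matrix.mul_zero, Matrix.zero_apply, add_zero,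
        Matrix.zero_mul, mul_diagonal]
      rw [Matrix.mul_apply, Finset.mul_sum]
      refine Fintype.sum_equiv (Equiv.subLeft i) _ _ fun j => ?_
      simp only [of_apply, Equiv.subLeft_apply]
      rw [mul_left_comm, ← hadd]; congr 2; abel
    · ext i k
      simp only [Matrix.add_apply, Matrix.mul_zero, Matrix.zero_apply, zero_add,
        Matrix.zero_mul, mul_diagonal]
      rw [Matrix.mul_apply, Finset.mul_sum, Finset.mul_sum, add_zero]
      refine Fintype.sum_equiv ((Equiv.addLeft ν).trans (Equiv.subRight i)) _ _ fun j => ?_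
      simp only [of_apply, Equiv.trans_apply, Equiv.coe_addLeft, Equiv.subRight_apply]
      have : Ω j k = Ω i k * (Ω (-ν) k * Ω (ν + j - i) k) := by
        rw [← hadd, ← hadd, show i + (-ν + (ν + j - i)) = j by abel]
      rw [this]
      ring
    · ext i k
      simp only [Matrix.add_apply, Matrix.mul_zero, Matrix.zero_apply, add_zero, zero_add,
        Matrix.zero_mul, mul_diagonal]
      rw [Matrix.mul_apply, Finset.mul_sum]
      refine Fintype.sum_equiv (Equiv.subLeft i) _ _ fun j => ?_
      simp only [of_apply, Equiv.subLeft_apply]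
      rw [mul_left_comm, ← hadd]; congr 2; abel
    · ext i k
      simp only [Matrix.add_apply, Matrix.mul_zero, Matrix.zero_apply, zero_add,
        Matrix.zero_mul, mul_diagonal]
      rw [Matrix.mul_apply, Finset.mul_sum]
      refine Fintype.sum_equiv (Equiv.subRight i) _ _ fun j => ?_
      simp only [of_apply, Equiv.subRight_apply]
      rw [mul_left_comm, ← hadd]; congr 2; abel
  have h := congrArg Matrix.det key
  rw [det_mul, det_mul, mul_comm] at h
  have h0 : (fromBlocks Ω 0 0 Ω).det ≠ 0 := by
    rw [det_fromBlocks_zero₂₁]; exact mul_ne_zero hΩ hΩ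
  rw [mul_left_cancel₀ h0 h, det_fromBlocks_diagonal]
  refine Finset.prod_congr rfl fun k _ => ?_
  ring

/-! ### The group ring of a cyclic group and the determinant of the dicyclic group -/

section Characters
variable {p : ℕ} {O : Type*} [CommRing O]

/-- The ring homomorphism `ℤ[C_p] → O` that extends the additive character `ψ`. -/
noncomputable def evalChar (ψ : AddChar (ZMod p) O) : ℤ[ZMod p] →+* O :=
  (AddMonoidAlgebra.lift ℤ O (ZMod p) ψ.toMonoidHom).toRingHom

theorem evalChar_single (ψ : AddChar (ZMod p) O) (i : ZMod p) (n : ℤ) :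
    evalChar ψ (AddMonoidAlgebra.single i n) = n * ψ i := by
  simp [evalChar, AddMonoidAlgebra.lift_single, zsmul_eq_mul]

theorem evalChar_apply [NeZero p] (ψ : AddChar (ZMod p) O) (F : ℤ[ZMod p]) :
    evalChar ψ F = ∑ i, (F.coeff i : O) * ψ i := by
  simp [evalChar, AddMonoidAlgebra.lift_apply, Finsupp.sum_fintype, zsmul_eq_mul]

/-- The involution of `ℤ[C_p]` that inverts the group elements. -/
noncomputable def conjInv : ℤ[ZMod p] →+* ℤ[ZMod p] :=
  AddMonoidAlgebra.mapDomainRingHom ℤ (negAddMonoidHom : ZMod p →+ ZMod p)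

@[simp] theorem conjInv_single (i : ZMod p) (n : ℤ) :
    conjInv (AddMonoidAlgebra.single i n) = AddMonoidAlgebra.single (-i) n := by
  simp [conjInv]

theorem coeff_conjInv (F : ℤ[ZMod p]) (i : ZMod p) : (conjInv F).coeff i = F.coeff (-i) := by
  have h := Finsupp.mapDomain_apply (f := fun i : ZMod p => -i) neg_injective F.coeff (-i)
  rw [neg_neg] at h
  exact h

theorem evalChar_conjInv [NeZero p] (ψ : AddChar (ZMod p) O) (F : ℤ[ZMod p]) :
    evalChar ψ (conjInv F) = ∑ i, (F.coeff i : O) * ψ (-i) := by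
  rw [evalChar_apply]
  refine Fintype.sum_equiv (Equiv.neg _) _ _ fun i => ?_
  simp [coeff_conjInv]

/-- The matrix of signs `(-1) ^ (s * t)`, the character table of the group of order two. -/
def signTable (O : Type*) [CommRing O] : Matrix (ZMod 2) (ZMod 2) O :=
  of fun s t => (-1) ^ (s * t).val

theorem det_signTable [IsDomain O] [CharZero O] : (signTable O).det ≠ 0 := by
  have h : (signTable O).det = -2 := by
    refine (Matrix.det_fin_two (signTable O)).trans ?_
    change (-1 : O) ^ (0 * 0 : ZMod 2).val * (-1) ^ (1 * 1 : ZMod 2).val -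
      (-1) ^ (0 * 1 : ZMod 2).val * (-1) ^ (1 * 0 : ZMod 2).val = -2
    simp [ZMod.val_one]
    norm_num
  rw [h]
  simp

theorem det_charTable_ne_zero [NeZero p] [IsDomain O] [CharZero O] {ψ : AddChar (ZMod p) O}
    (hψ : ψ.IsPrimitive) : (of fun i k : ZMod p => ψ (k * i)).det ≠ 0 := by
  have h : (of fun i k : ZMod p => ψ (k * i)) * (of fun i k : ZMod p => ψ (-(k * i))) =
      Matrix.diagonal fun _ => (p : O) := by
    ext i j
    simp only [Matrix.mul_apply, of_apply, diagonal_apply]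
    have := AddChar.sum_mulShift (i - j) hψ
    simp only [sub_eq_zero, ZMod.card] at this
    rw [show (if i = j then (p : O) else 0) = ((if i = j then p else 0 : ℕ) : O) by
      split_ifs <;> simp, ← this]
    refine Finset.sum_congr rfl fun k _ => ?_
    rw [← AddChar.map_add_eq_mul]
    congr 1; ring
  have h2 := congrArg Matrix.det h
  rw [det_mul, det_diagonal, Finset.prod_const] at h2
  refine left_ne_zero_of_mul (h2.trans_ne (pow_ne_zero _ ?_))
  exact_mod_cast NeZero.ne p

end Characters

section Factorization
variable {p : ℕ} [Fact p.Prime]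

/-- `ℤ[C_{2p}]` is `ℤ[C_p][w]` with `w ^ 2 = 1`; for a function `u` on `C_{2p}`, an element of that
ring, this is its coefficient in `ℤ[C_p]` at `w ^ s`. -/
noncomputable def component (hp : Nat.Coprime 2 p) (u : ZMod (2 * p) → ℤ) (s : ZMod 2) :
    ℤ[ZMod p] :=
  .ofCoeff (Finsupp.equivFunOnFinite.symm fun i => u ((ZMod.chineseRemainder hp).symm (s, i)))

/-- The abelian subgroup `C_{2p} = C_2 × C_p` of index two makes the matrix of the determinant a
block matrix, which the character table of `C_2 × C_p` diagonalizes. The first factor belongs to the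
trivial character of `C_2` and the second one to the sign. -/
theorem groupDeterminant_cast {O : Type*} [CommRing O] [IsDomain O] [CharZero O]
    (hp : Nat.Coprime 2 p) {ψ : AddChar (ZMod p) O} (hψ : ψ.IsPrimitive)
    (x : QuaternionGroup p → ℤ) {f₀ f₁ g₀ g₁ : ℤ[ZMod p]}
    (hf₀ : f₀ = component hp (fun i => x (.a i)) 0) (hf₁ : f₁ = component hp (fun i => x (.a i)) 1)
    (hg₀ : g₀ = component hp (fun i => x (.xa i)) 0)
    (hg₁ : g₁ = component hp (fun i => x (.xa i)) 1) :
    (groupDeterminant (QuaternionGroup p) x : O) =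
      (∏ k, evalChar (ψ.mulShift k)
        ((f₀ + f₁) * conjInv (f₀ + f₁) - (g₀ + g₁) * conjInv (g₀ + g₁))) *
      ∏ k, evalChar (ψ.mulShift k)
        ((f₀ - f₁) * conjInv (f₀ - f₁) + (g₀ - g₁) * conjInv (g₀ - g₁)) := by
  let e := ZMod.chineseRemainder hp
  let φ : (ZMod 2 × ZMod p) ⊕ (ZMod 2 × ZMod p) ≃ QuaternionGroup p :=
    { toFun := fun s => s.elim (fun i => .a (e.symm i)) (fun i => .xa (e.symm i))
      invFun := fun q => match q with
        | .a i => Sum.inl (e i)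
        | .xa i => Sum.inr (e i)
      left_inv := by rintro (i | i) <;> simp
      right_inv := by rintro (i | i) <;> simp }
  have hmat :
      ((of fun g h : QuaternionGroup p => x (g * h⁻¹)).map (Int.castRingHom O)).submatrix φ φ =
      fromBlocks (of fun i j => (x (.a (e.symm (i - j))) : O))
        (of fun i j => (x (.xa (e.symm ((1, 0) + j - i))) : O))
        (of fun i j => (x (.xa (e.symm (i - j))) : O))
        (of fun i j => (x (.a (e.symm (j - i))) : O)) := by
    have he : e.symm (1, 0) = (p : ZMod (2 * p)) := by
      rw [RingEquiv.symm_apply_eq, map_natCast]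
      have h1 : ((p : ℕ) : ZMod 2) = 1 :=
        (ZMod.natCast_eq_one_iff_odd).2 (Nat.coprime_two_left.1 hp)
      ext <;> simp [h1]
    have hpp : (p : ZMod (2 * p)) + p = 0 := by
      have := ZMod.natCast_self (2 * p)
      rw [← this]; push_cast; ring
    have hinv : ∀ j : ZMod (2 * p), (QuaternionGroup.xa j)⁻¹ = .xa (p + j) := fun _ => rfl
    have hinv' : ∀ j : ZMod (2 * p), (QuaternionGroup.a j)⁻¹ = .a (-j) := fun _ => rfl
    ext (i | i) (j | j)
    · simp [φ, hinv', sub_eq_add_neg]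
    · simp [φ, hinv, he]
    · simp [φ, hinv', sub_eq_add_neg]
    · simp [φ, hinv, ← add_assoc, hpp]
  let Ω : Matrix (ZMod 2 × ZMod p) (ZMod 2 × ZMod p) O :=
    kroneckerMap (· * ·) (signTable O) (of fun i k : ZMod p => ψ (k * i))
  have hΩ : Ω.det ≠ 0 := by
    rw [det_kronecker]
    exact mul_ne_zero (pow_ne_zero _ det_signTable) (pow_ne_zero _ (det_charTable_ne_zero hψ))
  have hadd : ∀ i j k, Ω (i + j) k = Ω i k * Ω j k := by
    rintro ⟨s, i⟩ ⟨t, j⟩ ⟨r, k⟩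
    simp only [Ω, kroneckerMap_apply, signTable, of_apply, Prod.mk_add_mk, mul_add,
      AddChar.map_add_eq_mul]
    rw [mul_mul_mul_comm, ← pow_add, add_mul, ZMod.val_add, ← neg_one_pow_eq_pow_mod_two]
  have hD : (groupDeterminant (QuaternionGroup p) x : O) =
      ((of fun g h : QuaternionGroup p => x (g * h⁻¹)).map (Int.castRingHom O)).det := by
    rw [groupDeterminant, ← RingHom.mapMatrix_apply, ← RingHom.map_det]
    rfl
  rw [hD, ← det_submatrix_equiv_self φ, hmat]
  have := det_dicyclic_blocks Ω hΩ hadd (1, 0) (fun i => (x (.a (e.symm i)) : O))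
    (fun i => (x (.xa (e.symm i)) : O))
  have hsum : ∀ (u : ZMod (2 * p) → ℤ) (t : ZMod 2) (k : ZMod p),
      ∑ i, (u (e.symm i) : O) * Ω i (t, k) =
        evalChar (ψ.mulShift k) (component hp u 0) +
          (-1) ^ t.val * evalChar (ψ.mulShift k) (component hp u 1) := by
    intro u t k
    rw [Fintype.sum_prod_type, show (Finset.univ : Finset (ZMod 2)) = {0, 1} from rfl,
      Finset.sum_pair (by decide), evalChar_apply, evalChar_apply, Finset.mul_sum]
    congr 1 <;> refine Finset.sum_congr rfl fun i _ => ?_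
    · simp [Ω, signTable, component, e]
    · simp [Ω, signTable, component, e]; ring
  have hsum' : ∀ (u : ZMod (2 * p) → ℤ) (t : ZMod 2) (k : ZMod p),
      ∑ i, (u (e.symm i) : O) * Ω (-i) (t, k) =
        evalChar (ψ.mulShift k) (conjInv (component hp u 0)) +
          (-1) ^ t.val * evalChar (ψ.mulShift k) (conjInv (component hp u 1)) := by
    intro u t k
    rw [Fintype.sum_prod_type, show (Finset.univ : Finset (ZMod 2)) = {0, 1} from rfl,
      Finset.sum_pair (by decide), evalChar_conjInv, evalChar_conjInv, Finset.mul_sum]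
    congr 1 <;> refine Finset.sum_congr rfl fun i _ => ?_
    · simp [Ω, signTable, component, e]
    · simp [Ω, signTable, component, e, show (-1 : ZMod 2) = 1 from rfl]; ring
  have hν : ∀ (t : ZMod 2) (k : ZMod p), Ω (-(1, 0)) (t, k) = (-1) ^ t.val := by
    intro t k
    simp [Ω, signTable, show (-1 : ZMod 2) = 1 from rfl]
  rw [this, Fintype.prod_prod_type, show (Finset.univ : Finset (ZMod 2)) = {0, 1} from rfl,
    Finset.prod_pair (by decide)]
  congr 1 <;> refine Finset.prod_congr rfl fun k _ => ?_
  · rw [hsum (fun i => x (.a i)), hsum' (fun i => x (.a i)), hsum (fun i => x (.xa i)),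
      hsum' (fun i => x (.xa i)), hν, ← hf₀, ← hf₁, ← hg₀, ← hg₁]
    simp only [map_add, map_sub, map_mul, ZMod.val_zero, pow_zero]
    ring
  · rw [hsum (fun i => x (.a i)), hsum' (fun i => x (.a i)), hsum (fun i => x (.xa i)),
      hsum' (fun i => x (.xa i)), hν, ← hf₀, ← hf₁, ← hg₀, ← hg₁]
    simp only [map_add, map_sub, map_mul, show (1 : ZMod 2).val = 1 from rfl, pow_one]
    ring

end Factorization

/-! ### Cyclotomic integers and the norm of an element of the group ring -/

section CyclotomicIntegers
open NumberField
variable {p : ℕ} [Fact p.Prime]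

instance isCyclotomicExtension_cyclotomicField :
    IsCyclotomicExtension {p} ℚ (CyclotomicField p ℚ) :=
  have : NeZero ((p : ℕ) : ℚ) := ⟨by exact_mod_cast (Fact.out : p.Prime).ne_zero⟩
  CyclotomicField.isCyclotomicExtension p ℚ

variable (p) in
/-- The ring of integers of the `p`-th cyclotomic field. -/
abbrev CyclotomicInt : Type := 𝓞 (CyclotomicField p ℚ)

variable (p) in
/-- The additive character `i ↦ ζ ^ i` of `ZMod p`, for a primitive `p`-th root of unity `ζ`. -/
noncomputable def zetaChar : AddChar (ZMod p) (CyclotomicInt p) :=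
  AddChar.zmodChar p (IsCyclotomicExtension.zeta_spec p ℚ
    (CyclotomicField p ℚ)).toInteger_isPrimitiveRoot.pow_eq_one

theorem zetaChar_isPrimitive : (zetaChar p).IsPrimitive :=
  AddChar.zmodChar_primitive_of_primitive_root p (IsCyclotomicExtension.zeta_spec p ℚ
    (CyclotomicField p ℚ)).toInteger_isPrimitiveRoot

/-- The value of an element of `ℤ[C_p]` at the root of unity `ζ ^ k`. -/
noncomputable def evalZeta (k : ZMod p) : ℤ[ZMod p] →+* CyclotomicInt p :=
  evalChar ((zetaChar p).mulShift k)

theorem evalZeta_apply (k : ZMod p) (F : ℤ[ZMod p]) :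
    evalZeta k F = ∑ i, (F.coeff i : CyclotomicInt p) * zetaChar p (k * i) := by
  simp [evalZeta, evalChar_apply]

theorem evalZeta_single (k i : ZMod p) (n : ℤ) :
    evalZeta k (.single i n) = n * zetaChar p (k * i) := by
  simp [evalZeta, evalChar_single]

theorem evalZeta_conjInv (k : ZMod p) (F : ℤ[ZMod p]) :
    evalZeta k (conjInv F) = evalZeta (-k) F := by
  rw [evalZeta, evalChar_conjInv, evalZeta_apply]
  simp

/-- The augmentation `ℤ[C_p] → ℤ`. -/
noncomputable def aug : ℤ[ZMod p] →+* ℤ := evalChar 1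

@[simp] theorem aug_single (i : ZMod p) (n : ℤ) : aug (.single i n : ℤ[ZMod p]) = n := by
  simp [aug, evalChar_single]

theorem evalZeta_zero (F : ℤ[ZMod p]) : evalZeta 0 F = (aug F : CyclotomicInt p) := by
  simp [evalZeta_apply, aug, evalChar_apply]

@[simp] theorem aug_conjInv (F : ℤ[ZMod p]) : aug (conjInv F) = aug F := by
  rw [aug, evalChar_conjInv, evalChar_apply]
  simp

/-- The Galois group permutes the values of an element of `ℤ[C_p]` at the roots of unity. -/
theorem exists_galois_smul (σ : Gal((CyclotomicField p ℚ)/ℚ)) :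
    ∃ a : ZMod p, a ≠ 0 ∧ ∀ (k : ZMod p) (F : ℤ[ZMod p]),
      σ (evalZeta k F : CyclotomicField p ℚ) = (evalZeta (a * k) F : CyclotomicField p ℚ) := by
  have hζ := IsCyclotomicExtension.zeta_spec p ℚ (CyclotomicField p ℚ)
  refine ⟨hζ.autToPow ℚ σ, Units.ne_zero _, fun k F => ?_⟩
  have hψ : ∀ i : ZMod p, σ (zetaChar p i : CyclotomicField p ℚ) =
      (zetaChar p (hζ.autToPow ℚ σ * i) : CyclotomicField p ℚ) := by
    intro i
    have h1 : zetaChar p i = hζ.toInteger ^ i.val := AddChar.zmodChar_apply _ _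
    have h2 : zetaChar p (hζ.autToPow ℚ σ * i) =
        hζ.toInteger ^ ((hζ.autToPow ℚ σ : ZMod p).val * i.val) := by
      refine Eq.trans ?_ (AddChar.zmodChar_apply' hζ.toInteger_isPrimitiveRoot.pow_eq_one _)
      push_cast [ZMod.natCast_zmod_val]
      rfl
    rw [h1, h2, pow_mul]
    push_cast
    rw [map_pow]
    congr 1
    exact (hζ.autToPow_spec ℚ σ).symm
  simp only [evalZeta_apply, map_sum, map_mul, map_intCast, hψ, mul_assoc]

theorem exists_intCast_eq_of_fixed (z : CyclotomicInt p)
    (hz : ∀ σ : Gal((CyclotomicField p ℚ)/ℚ),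
      σ (z : CyclotomicField p ℚ) = (z : CyclotomicField p ℚ)) :
    ∃ n : ℤ, (n : CyclotomicInt p) = z := by
  have : IsGalois ℚ (CyclotomicField p ℚ) := IsCyclotomicExtension.isGalois {p} ℚ _
  obtain ⟨q, hq⟩ := (IsGalois.mem_range_algebraMap_iff_fixed (z : CyclotomicField p ℚ)).2 hz
  have hint : IsIntegral ℤ q := by
    rw [← isIntegral_algebraMap_iff (algebraMap ℚ (CyclotomicField p ℚ)).injective, hq]
    exact z.2
  obtain ⟨n, hn⟩ := IsIntegrallyClosed.isIntegral_iff.1 hint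
  refine ⟨n, RingOfIntegers.ext ?_⟩
  rw [← hq, ← hn]
  simp

theorem exists_cycNorm (F : ℤ[ZMod p]) :
    ∃ n : ℤ, (n : CyclotomicInt p) = ∏ k ∈ Finset.univ.erase 0, evalZeta k F := by
  refine exists_intCast_eq_of_fixed _ fun σ => ?_
  obtain ⟨a, ha, h⟩ := exists_galois_smul σ
  simp only [map_prod, h]
  refine Finset.prod_nbij' (fun k => a * k) (fun k => a⁻¹ * k) ?_ ?_ ?_ ?_ ?_ <;>
    simp [ha]

/-- The product of the values of `F` at the primitive `p`-th roots of unity, an integer. -/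
noncomputable def cycNorm (F : ℤ[ZMod p]) : ℤ := (exists_cycNorm F).choose

theorem cast_cycNorm (F : ℤ[ZMod p]) :
    (cycNorm F : CyclotomicInt p) = ∏ k ∈ Finset.univ.erase 0, evalZeta k F :=
  (exists_cycNorm F).choose_spec

/-- For a symmetric element the characters `k` and `-k` give the same value, so one character of
each pair suffices to give an integer. -/
theorem exists_halfNorm {F : ℤ[ZMod p]} (hF : conjInv F = F) :
    ∃ n : ℤ, (n : CyclotomicInt p) = ∏ k ∈ Finset.Ico 1 (p / 2).succ, evalZeta (k : ZMod p) F := by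
  refine exists_intCast_eq_of_fixed _ fun σ => ?_
  obtain ⟨a, ha, h⟩ := exists_galois_smul σ
  simp only [map_prod, h]
  have hsymm : ∀ k : ZMod p, evalZeta k F = evalZeta ((k.valMinAbs.natAbs : ℕ) : ZMod p) F := by
    intro k
    have hk' := ZMod.coe_valMinAbs k
    rcases Int.natAbs_eq k.valMinAbs with hk | hk
    · conv_lhs => rw [← hk', hk, Int.cast_natCast]
    · conv_lhs => rw [← hF, evalZeta_conjInv, ← hk', hk, Int.cast_neg, neg_neg, Int.cast_natCast]
  have key := congrArg (fun s => (s.map fun k : ℕ =>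
    (evalZeta (k : ZMod p) F : CyclotomicField p ℚ)).prod)
    (ZMod.Ico_map_valMinAbs_natAbs_eq_Ico_map_id p a ha)
  simp only [Multiset.map_map, Function.comp_def] at key
  rw [Finset.prod_eq_multiset_prod, Finset.prod_eq_multiset_prod, ← key]
  simp only [hsymm (a * _)]

theorem prod_erase_zero_eq {M : Type*} [CommMonoid M] (f : ZMod p → M) :
    ∏ k ∈ Finset.univ.erase 0, f k = ∏ k ∈ Finset.Ico 1 p, f (k : ZMod p) := by
  refine Finset.prod_nbij' (fun k => k.val) (fun k => (k : ZMod p)) ?_ ?_ ?_ ?_ ?_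
  · intro k hk
    simp only [Finset.mem_erase, Finset.mem_univ, and_true] at hk
    simp [ZMod.val_lt, Nat.one_le_iff_ne_zero, hk]
  · intro k hk
    simp only [Finset.mem_Ico] at hk
    simp only [Finset.mem_erase, Finset.mem_univ, and_true, ne_eq, ZMod.natCast_eq_zero_iff]
    exact Nat.not_dvd_of_pos_of_lt hk.1 hk.2
  · simp
  · intro k hk
    simp only [Finset.mem_Ico] at hk
    exact ZMod.val_cast_of_lt hk.2
  · simp

theorem cast_cycNorm_eq_sq (hp : p ≠ 2) {F : ℤ[ZMod p]} (hF : conjInv F = F) :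
    (cycNorm F : CyclotomicInt p) =
      (∏ k ∈ Finset.Ico 1 (p / 2).succ, evalZeta (k : ZMod p) F) ^ 2 := by
  have hodd : p % 2 = 1 := Nat.odd_iff.1 ((Fact.out : p.Prime).odd_of_ne_two hp)
  rw [cast_cycNorm, prod_erase_zero_eq, ← Finset.prod_Ico_consecutive _ (n := (p / 2).succ)
    (by omega) (by omega), sq]
  congr 1
  have := Finset.prod_Ico_reflect (fun k : ℕ => evalZeta (k : ZMod p) F) 1
    (m := (p / 2).succ) (n := p) (by omega)
  rw [show p + 1 - (p / 2).succ = (p / 2).succ by omega, show p + 1 - 1 = p by omega] at this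
  rw [← this]
  refine Finset.prod_congr rfl fun k hk => ?_
  simp only [Finset.mem_Ico] at hk
  rw [Nat.cast_sub (by omega), ZMod.natCast_self, zero_sub, ← evalZeta_conjInv, hF]

theorem zeta_sub_one_dvd_evalZeta_sub (k : ZMod p) (F : ℤ[ZMod p]) :
    (IsCyclotomicExtension.zeta_spec p ℚ (CyclotomicField p ℚ)).toInteger - 1 ∣
      evalZeta k F - (aug F : CyclotomicInt p) := by
  rw [evalZeta_apply, aug, evalChar_apply]
  push_cast
  rw [← Finset.sum_sub_distrib]
  refine Finset.dvd_sum fun i _ => ?_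
  rw [← mul_sub]
  refine Dvd.dvd.mul_left ?_ _
  rw [zetaChar, AddChar.zmodChar_apply]
  simpa using sub_one_dvd_pow_sub_one _ _

theorem dvd_prod_sub_prod {ι M : Type*} [CommRing M] {d : M} {s : Finset ι} {f g : ι → M}
    (h : ∀ k ∈ s, d ∣ f k - g k) : d ∣ ∏ k ∈ s, f k - ∏ k ∈ s, g k := by
  simp only [← Ideal.mem_span_singleton, ← Ideal.Quotient.eq, map_prod] at h ⊢
  exact Finset.prod_congr rfl h

/-- All the values of `F` are congruent modulo the prime `ζ - 1` above `p`. -/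
theorem cycNorm_modEq (F : ℤ[ZMod p]) : aug F ^ (p - 1) ≡ cycNorm F [ZMOD p] := by
  have hζ := IsCyclotomicExtension.zeta_spec p ℚ (CyclotomicField p ℚ)
  have h := dvd_prod_sub_prod (s := Finset.univ.erase 0)
    fun k _ => zeta_sub_one_dvd_evalZeta_sub (p := p) k F
  rw [← cast_cycNorm, Finset.prod_const, Finset.card_erase_of_mem (Finset.mem_univ _),
    Finset.card_univ, ZMod.card] at h
  rw [Int.modEq_iff_dvd, ← IsCyclotomicExtension.Rat.zeta_sub_one_dvd_intCast_iff' p hζ]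
  exact_mod_cast h

/-- A congruence modulo an integer can be tested in the cyclotomic integers. -/
theorem intCast_dvd_intCast_iff {a b : ℤ} :
    (a : CyclotomicInt p) ∣ (b : CyclotomicInt p) ↔ a ∣ b := by
  refine ⟨fun ⟨z, hz⟩ => ?_, fun h => ?_⟩
  · by_cases ha : a = 0
    · subst ha
      simp at hz
      simp [hz]
    obtain ⟨n, rfl⟩ := exists_intCast_eq_of_fixed z fun σ => by
      have h1 : (b : CyclotomicField p ℚ) = a * (z : CyclotomicField p ℚ) := by
        simpa using congrArg (algebraMap (CyclotomicInt p) (CyclotomicField p ℚ)) hz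
      have h2 := congrArg σ h1
      rw [map_mul, map_intCast, map_intCast, h1] at h2
      exact (mul_left_cancel₀ (by exact_mod_cast ha) h2).symm
    exact ⟨n, by exact_mod_cast hz⟩
  · obtain ⟨c, rfl⟩ := h
    simp

/-- The cyclotomic norm of a symmetric element is a square, and its root is known modulo `p`. -/
theorem exists_cycNorm_eq_sq (hp : p ≠ 2) {F : ℤ[ZMod p]} (hF : conjInv F = F) :
    ∃ n : ℤ, cycNorm F = n ^ 2 ∧ aug F ^ (p / 2) ≡ n [ZMOD p] := by
  obtain ⟨n, hn⟩ := exists_halfNorm hF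
  refine ⟨n, ?_, ?_⟩
  · have := cast_cycNorm_eq_sq hp hF
    rw [← hn] at this
    exact_mod_cast this
  · have hζ := IsCyclotomicExtension.zeta_spec p ℚ (CyclotomicField p ℚ)
    have h := dvd_prod_sub_prod (s := Finset.Ico 1 (p / 2).succ)
      fun k _ => zeta_sub_one_dvd_evalZeta_sub (p := p) (k : ℕ) F
    rw [← hn, Finset.prod_const, Nat.card_Ico, Nat.succ_sub_one] at h
    rw [Int.modEq_iff_dvd, ← IsCyclotomicExtension.Rat.zeta_sub_one_dvd_intCast_iff' p hζ]
    exact_mod_cast h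

theorem cycNorm_modEq_of_dvd_sub {F G : ℤ[ZMod p]} {n : ℤ} (h : (n : ℤ[ZMod p]) ∣ F - G) :
    cycNorm F ≡ cycNorm G [ZMOD n] := by
  refine Int.ModEq.symm (Int.modEq_iff_dvd.2 ?_)
  rw [← intCast_dvd_intCast_iff (p := p)]
  push_cast [cast_cycNorm]
  refine dvd_prod_sub_prod fun k _ => ?_
  rw [← map_sub]
  simpa using map_dvd (evalZeta k) h

end CyclotomicIntegers

/-! ### Determinants as values on pairs congruent modulo two -/

section CycNorm
open NumberField
variable {p : ℕ} [Fact p.Prime]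

theorem cycNorm_mul (F G : ℤ[ZMod p]) : cycNorm (F * G) = cycNorm F * cycNorm G := by
  have : (cycNorm (F * G) : CyclotomicInt p) = (cycNorm F * cycNorm G : ℤ) := by
    push_cast [cast_cycNorm]
    simp [Finset.prod_mul_distrib]
  exact_mod_cast this

@[simp] theorem cycNorm_one : cycNorm (1 : ℤ[ZMod p]) = 1 := by
  have : (cycNorm (1 : ℤ[ZMod p]) : CyclotomicInt p) = (1 : ℤ) := by simp [cast_cycNorm]
  exact_mod_cast this

theorem cycNorm_pow (F : ℤ[ZMod p]) (n : ℕ) : cycNorm (F ^ n) = cycNorm F ^ n := by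
  induction n with
  | zero => simp
  | succ n ih => rw [pow_succ, cycNorm_mul, ih, pow_succ]

theorem cycNorm_neg (hp : p ≠ 2) (F : ℤ[ZMod p]) : cycNorm (-F) = cycNorm F := by
  have h : Even (p - 1) := (Fact.out : p.Prime).even_sub_one hp
  have : (cycNorm (-F) : CyclotomicInt p) = (cycNorm F : ℤ) := by
    simp only [cast_cycNorm, map_neg, Finset.prod_neg]
    rw [Finset.card_erase_of_mem (Finset.mem_univ _), Finset.card_univ, ZMod.card, h.neg_one_pow,
      one_mul]
  exact_mod_cast this

theorem cycNorm_congr {F G : ℤ[ZMod p]} (h : ∀ k : ZMod p, k ≠ 0 → evalZeta k F = evalZeta k G) :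
    cycNorm F = cycNorm G := by
  have : (cycNorm F : CyclotomicInt p) = (cycNorm G : ℤ) := by
    simp only [cast_cycNorm]
    exact Finset.prod_congr rfl fun k hk => h k (Finset.ne_of_mem_erase hk)
  exact_mod_cast this

theorem prod_evalZeta (F : ℤ[ZMod p]) :
    ∏ k, evalZeta k F = ((aug F * cycNorm F : ℤ) : CyclotomicInt p) := by
  rw [← Finset.mul_prod_erase _ _ (Finset.mem_univ (0 : ZMod p)), evalZeta_zero, ← cast_cycNorm]
  push_cast
  rfl

/-- At each character `|f|² + |g|² ≥ 2 |f| |g|`, and the norms of `f` and `g` are nonzero integers.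
-/
theorem two_pow_le_cycNorm {f g : ℤ[ZMod p]} (hf : cycNorm f ≠ 0) (hg : cycNorm g ≠ 0) :
    2 ^ (p - 1) ≤ cycNorm (f * conjInv f + g * conjInv g) := by
  let φ : CyclotomicInt p →+* ℂ :=
    (Classical.arbitrary (CyclotomicField p ℚ →+* ℂ)).comp (algebraMap _ _)
  let ψ : AddChar (ZMod p) ℂ := (φ : CyclotomicInt p →* ℂ).compAddChar (zetaChar p)
  have hφ (k : ZMod p) (F : ℤ[ZMod p]) :
      φ (evalZeta k F) = ∑ i, (F.coeff i : ℂ) * ψ (k * i) := by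
    simp [evalZeta_apply, ψ]
  have hconj (k : ZMod p) (F : ℤ[ZMod p]) :
      φ (evalZeta k (conjInv F)) = starRingEnd ℂ (φ (evalZeta k F)) := by
    rw [evalZeta_conjInv, hφ, hφ, map_sum]
    refine Finset.sum_congr rfl fun i _ => ?_
    rw [map_mul (starRingEnd ℂ), neg_mul, AddChar.map_neg_eq_conj]
    simp
  have hnorm (F : ℤ[ZMod p]) :
      (|cycNorm F| : ℝ) = ∏ k ∈ Finset.univ.erase 0, ‖φ (evalZeta k F)‖ := by
    have := congrArg (fun z => ‖φ z‖) (cast_cycNorm F)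
    simpa using this
  have hsum : (cycNorm (f * conjInv f + g * conjInv g) : ℝ) =
      ∏ k ∈ Finset.univ.erase 0, (‖φ (evalZeta k f)‖ ^ 2 + ‖φ (evalZeta k g)‖ ^ 2) := by
    have := congrArg φ (cast_cycNorm (f * conjInv f + g * conjInv g))
    rw [map_prod, map_intCast] at this
    have h2 : (cycNorm (f * conjInv f + g * conjInv g) : ℂ) =
      ((∏ k ∈ Finset.univ.erase 0, (‖φ (evalZeta k f)‖ ^ 2 + ‖φ (evalZeta k g)‖ ^ 2) : ℝ) : ℂ) := by
      rw [this]
      push_cast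
      refine Finset.prod_congr rfl fun k _ => ?_
      rw [map_add, map_mul, map_mul, map_add, map_mul, map_mul, hconj, hconj, Complex.mul_conj',
        Complex.mul_conj']
    exact_mod_cast h2
  have hle : (2 : ℝ) ^ (p - 1) * (|cycNorm f| * |cycNorm g|) ≤
      cycNorm (f * conjInv f + g * conjInv g) := by
    rw [hsum]
    push_cast
    rw [hnorm, hnorm, ← Finset.prod_mul_distrib]
    have hc : (2 : ℝ) ^ (p - 1) = ∏ k ∈ Finset.univ.erase (0 : ZMod p), 2 := by
      rw [Finset.prod_const, Finset.card_erase_of_mem (Finset.mem_univ _), Finset.card_univ,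
        ZMod.card]
    rw [hc, ← Finset.prod_mul_distrib]
    refine Finset.prod_le_prod (fun _ _ => by positivity) fun k _ => ?_
    nlinarith [sq_nonneg (‖φ (evalZeta k f)‖ - ‖φ (evalZeta k g)‖)]
  have h1 : (2 : ℤ) ^ (p - 1) * (|cycNorm f| * |cycNorm g|) ≤
      cycNorm (f * conjInv f + g * conjInv g) := by exact_mod_cast hle
  have h2 : 1 ≤ |cycNorm f| := Int.one_le_abs hf
  have h3 : 1 ≤ |cycNorm g| := Int.one_le_abs hg
  have h4 : (0 : ℤ) < 2 ^ (p - 1) := by positivity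
  nlinarith [mul_le_mul h2 h3 zero_le_one (by positivity)]

theorem dvd_aug_of_cycNorm_eq_zero {F : ℤ[ZMod p]} (h : cycNorm F = 0) : (p : ℤ) ∣ aug F := by
  have := cycNorm_modEq F
  rw [h] at this
  exact (Nat.prime_iff_prime_int.1 Fact.out).dvd_of_dvd_pow (Int.modEq_zero_iff_dvd.1 this)

/-- The pairs `(f, f')` of elements of `ℤ[C_p]` congruent modulo `2` are the elements of
`ℤ[C_{2p}]`, through its two projections to `ℤ[C_p]`. -/
theorem mem_dicyclicDeterminants_iff (hp : p ≠ 2) {d : ℤ} :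
    d ∈ dicyclicDeterminants p ↔ ∃ f f' g g' : ℤ[ZMod p], 2 ∣ f - f' ∧ 2 ∣ g - g' ∧
      d = aug (f * conjInv f - g * conjInv g) * cycNorm (f * conjInv f - g * conjInv g) *
        (aug (f' * conjInv f' + g' * conjInv g') *
          cycNorm (f' * conjInv f' + g' * conjInv g')) := by
  have hcop : Nat.Coprime 2 p :=
    (Nat.coprime_primes Nat.prime_two Fact.out).2 (Ne.symm hp)
  constructor
  · rintro ⟨x, rfl⟩
    set f₀ := component hcop (fun i => x (.a i)) 0 with hf₀
    set f₁ := component hcop (fun i => x (.a i)) 1 with hf₁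
    set g₀ := component hcop (fun i => x (.xa i)) 0 with hg₀
    set g₁ := component hcop (fun i => x (.xa i)) 1 with hg₁
    refine ⟨f₀ + f₁, f₀ - f₁, g₀ + g₁, g₀ - g₁, ⟨f₁, by ring⟩, ⟨g₁, by ring⟩, ?_⟩
    have := groupDeterminant_cast hcop zetaChar_isPrimitive x hf₀ hf₁ hg₀ hg₁
    change _ = (∏ k, evalZeta k _) * ∏ k, evalZeta k _ at this
    rw [prod_evalZeta, prod_evalZeta, ← Int.cast_mul] at this
    exact_mod_cast this
  · rintro ⟨f, f', g, g', ⟨f₁, hf⟩, ⟨g₁, hg⟩, rfl⟩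
    let u (a : ZMod 2 → ℤ[ZMod p]) (i : ZMod (2 * p)) : ℤ :=
      (a (ZMod.chineseRemainder hcop i).1).coeff (ZMod.chineseRemainder hcop i).2
    have hu (a : ZMod 2 → ℤ[ZMod p]) (s : ZMod 2) : a s = component hcop (u a) s := by
      ext i
      simp [component, u]
    let x : QuaternionGroup p → ℤ
      | .a i => u ![f - f₁, f₁] i
      | .xa i => u ![g - g₁, g₁] i
    refine ⟨x, ?_⟩
    have := groupDeterminant_cast hcop zetaChar_isPrimitive x (hu ![f - f₁, f₁] 0)
      (hu ![f - f₁, f₁] 1) (hu ![g - g₁, g₁] 0) (hu ![g - g₁, g₁] 1)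
    change _ = (∏ k, evalChar _ ((f - f₁ + f₁) * conjInv (f - f₁ + f₁) -
        (g - g₁ + g₁) * conjInv (g - g₁ + g₁))) *
      (∏ k, evalChar _ ((f - f₁ - f₁) * conjInv (f - f₁ - f₁) +
        (g - g₁ - g₁) * conjInv (g - g₁ - g₁))) at this
    rw [sub_add_cancel, sub_add_cancel, show f - f₁ - f₁ = f' by linear_combination hf,
      show g - g₁ - g₁ = g' by linear_combination hg] at this
    change _ = (∏ k, evalZeta k _) * ∏ k, evalZeta k _ at this
    rw [prod_evalZeta, prod_evalZeta, ← Int.cast_mul] at this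
    exact_mod_cast this

end CycNorm

/-! ### Restrictions on the determinants -/

section Necessary
variable {p : ℕ} [Fact p.Prime]

/-- The factorization behind all the restrictions: `a, b, c, e` are the augmentations of `f, g, f',
g'`, and `A, B` are the square roots of the cyclotomic norms. -/
theorem exists_factorization (hp : p ≠ 2) {d : ℤ} (hd : d ∈ dicyclicDeterminants p) :
    ∃ a b c e A B : ℤ, 2 ∣ a - c ∧ 2 ∣ b - e ∧ 2 ∣ A - B ∧
      ((p : ℤ) ∣ A ↔ (p : ℤ) ∣ a ^ 2 - b ^ 2) ∧ ((p : ℤ) ∣ B ↔ (p : ℤ) ∣ c ^ 2 + e ^ 2) ∧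
      ((p : ℤ) ∣ c ∨ (p : ℤ) ∣ e ∨ 2 ^ (p - 1) ≤ B ^ 2) ∧
      d = (a ^ 2 - b ^ 2) * A ^ 2 * ((c ^ 2 + e ^ 2) * B ^ 2) := by
  obtain ⟨f, f', g, g', ⟨u, hu⟩, ⟨v, hv⟩, rfl⟩ := (mem_dicyclicDeterminants_iff hp).1 hd
  have hsymm : ∀ F : ℤ[ZMod p], conjInv (conjInv F) = F := by
    intro F
    ext i
    simp [coeff_conjInv]
  obtain ⟨A, hA, hA'⟩ := exists_cycNorm_eq_sq hp (F := f * conjInv f - g * conjInv g)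
    (by simp only [map_sub, map_mul, hsymm]; ring)
  obtain ⟨B, hB, hB'⟩ := exists_cycNorm_eq_sq hp (F := f' * conjInv f' + g' * conjInv g')
    (by simp only [map_add, map_mul, hsymm]; ring)
  have hpr : Prime (p : ℤ) := Nat.prime_iff_prime_int.1 Fact.out
  have hp2 : p / 2 ≠ 0 := by
    have := (Fact.out : p.Prime).two_le
    omega
  have hdvd {x y : ℤ} (h : x ^ (p / 2) ≡ y [ZMOD p]) : (p : ℤ) ∣ y ↔ (p : ℤ) ∣ x := by
    rw [← hpr.dvd_pow_iff_dvd hp2 (a := x), ← Int.modEq_zero_iff_dvd, ← Int.modEq_zero_iff_dvd]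
    exact ⟨h.trans, h.symm.trans⟩
  have e1 : aug (f * conjInv f - g * conjInv g) = aug f ^ 2 - aug g ^ 2 := by simp [sq]
  have e2 : aug (f' * conjInv f' + g' * conjInv g') = aug f' ^ 2 + aug g' ^ 2 := by simp [sq]
  refine ⟨aug f, aug g, aug f', aug g', A, B, ⟨aug u, ?_⟩, ⟨aug v, ?_⟩, ?_, ?_, ?_, ?_, ?_⟩
  · rw [← map_sub, hu, map_mul, map_ofNat aug 2]
  · rw [← map_sub, hv, map_mul, map_ofNat aug 2]
  · have h : A ^ 2 ≡ B ^ 2 [ZMOD 2] := by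
      rw [← hA, ← hB]
      refine cycNorm_modEq_of_dvd_sub ⟨f' * conjInv u + u * conjInv f' + 2 * (u * conjInv u)
        - g' * conjInv v - v * conjInv g' - 2 * (v * conjInv v) - g' * conjInv g', ?_⟩
      have h2 : conjInv (2 : ℤ[ZMod p]) = 2 := map_ofNat _ 2
      rw [show f = f' + 2 * u by linear_combination hu,
        show g = g' + 2 * v by linear_combination hv]
      simp only [map_add, map_mul, h2]
      push_cast
      ring
    have h3 := h.dvd
    rw [sq_sub_sq] at h3
    rcases Int.prime_two.dvd_or_dvd h3 with h4 | h4 <;> omega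
  · rw [hdvd (e1 ▸ hA')]
  · rw [hdvd (e2 ▸ hB')]
  · by_cases hf : cycNorm f' = 0
    · exact .inl (dvd_aug_of_cycNorm_eq_zero hf)
    by_cases hg : cycNorm g' = 0
    · exact .inr (.inl (dvd_aug_of_cycNorm_eq_zero hg))
    exact .inr (.inr (hB ▸ two_pow_le_cycNorm hf hg))
  · rw [e1, e2, hA, hB]

theorem eight_dvd_sq_sub_sq {a b : ℤ} (ha : Odd a) (hb : Odd b) : 8 ∣ a ^ 2 - b ^ 2 := by
  have := Int.eight_dvd_sq_sub_one_of_odd ha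
  have := Int.eight_dvd_sq_sub_one_of_odd hb
  omega

theorem four_dvd_sq_sub_sq {a b : ℤ} (h : 2 ∣ a ^ 2 - b ^ 2) : 4 ∣ a ^ 2 - b ^ 2 := by
  have h1 : 2 ∣ a - b ∧ 2 ∣ a + b := by
    rw [sq_sub_sq] at h
    rcases Int.prime_two.dvd_or_dvd h with h | h <;> omega
  obtain ⟨⟨u, hu⟩, ⟨v, hv⟩⟩ := h1
  exact ⟨u * v, by rw [sq_sub_sq, hu, hv]; ring⟩

theorem dvd_add_of_dvd_sq_sub_sq {a b : ℤ} (h : 2 ∣ a ^ 2 - b ^ 2) : 2 ∣ a + b := by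
  rw [sq_sub_sq] at h
  rcases Int.prime_two.dvd_or_dvd h with h | h <;> omega

theorem dvd_add_of_dvd_sq_add_sq {a b : ℤ} (h : 2 ∣ a ^ 2 + b ^ 2) : 2 ∣ a + b := by
  refine dvd_add_of_dvd_sq_sub_sq ?_
  rw [show a ^ 2 - b ^ 2 = a ^ 2 + b ^ 2 - 2 * b ^ 2 by ring]
  exact dvd_sub h (dvd_mul_right _ _)

theorem sixteen_dvd_of_dvd_add {a b c e : ℤ} (hac : 2 ∣ a - c) (hbe : 2 ∣ b - e)
    (h : 2 ∣ a + b) : 16 ∣ (a ^ 2 - b ^ 2) * (c ^ 2 + e ^ 2) := by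
  rcases Int.even_or_odd a with ha | ha
  · obtain ⟨a', rfl⟩ := ha.two_dvd
    obtain ⟨b', rfl⟩ : 2 ∣ b := by omega
    obtain ⟨c', rfl⟩ : 2 ∣ c := by omega
    obtain ⟨e', rfl⟩ : 2 ∣ e := by omega
    exact ⟨(a' ^ 2 - b' ^ 2) * (c' ^ 2 + e' ^ 2), by ring⟩
  · rw [show (16 : ℤ) = 8 * 2 by norm_num]
    have h1 := Int.odd_iff.1 ha
    have hb : Odd b := Int.odd_iff.2 (by omega)
    have hc : Odd c := Int.odd_iff.2 (by omega)
    have he : Odd e := Int.odd_iff.2 (by omega)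
    exact mul_dvd_mul (eight_dvd_sq_sub_sq ha hb) (hc.pow.add_odd he.pow).two_dvd

theorem sixteen_dvd_of_two_dvd {a b c e A B d : ℤ} (hac : 2 ∣ a - c) (hbe : 2 ∣ b - e)
    (hAB : 2 ∣ A - B) (hd : d = (a ^ 2 - b ^ 2) * A ^ 2 * ((c ^ 2 + e ^ 2) * B ^ 2))
    (h : 2 ∣ d) : 16 ∣ d := by
  have h2 := Int.prime_two
  by_cases hab : 2 ∣ a + b
  · obtain ⟨t, ht⟩ := sixteen_dvd_of_dvd_add hac hbe hab
    exact ⟨t * (A ^ 2 * B ^ 2), by rw [hd]; linear_combination A ^ 2 * B ^ 2 * ht⟩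
  · have hA : 2 ∣ A := by
      rw [hd] at h
      rcases h2.dvd_or_dvd h with h | h <;> rcases h2.dvd_or_dvd h with h | h
      · exact absurd (dvd_add_of_dvd_sq_sub_sq h) hab
      · exact h2.dvd_of_dvd_pow h
      · have := dvd_add_of_dvd_sq_add_sq h
        omega
      · have := h2.dvd_of_dvd_pow h
        omega
    obtain ⟨A', rfl⟩ := hA
    obtain ⟨B', rfl⟩ : 2 ∣ B := by omega
    exact ⟨(a ^ 2 - b ^ 2) * A' ^ 2 * ((c ^ 2 + e ^ 2) * B' ^ 2), by rw [hd]; ring⟩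

/-- The case of a determinant exactly divisible by `2 ^ 5`: the odd part `q` of the factor
`c ^ 2 + e ^ 2` is half a sum of two odd squares. -/
theorem exists_odd_sq_add_sq {a b c e A B n : ℤ} (hac : 2 ∣ a - c) (hbe : 2 ∣ b - e)
    (hAB : 2 ∣ A - B) (hn : Odd n)
    (hd : 2 ^ 5 * n = (a ^ 2 - b ^ 2) * A ^ 2 * ((c ^ 2 + e ^ 2) * B ^ 2)) :
    Odd B ∧ ∃ r s q : ℤ, Odd r ∧ Odd s ∧ 2 * q = r ^ 2 + s ^ 2 ∧ q * B ^ 2 ∣ n ∧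
      ((c = r ∧ e = s) ∨ (c = 2 * r ∧ e = 2 * s)) := by
  have h2 := Int.prime_two
  have hn' := Int.odd_iff.1 hn
  have hB : Odd B := by
    by_contra hB
    obtain ⟨B', rfl⟩ := (Int.not_odd_iff_even.1 hB).two_dvd
    obtain ⟨A', rfl⟩ : 2 ∣ A := by omega
    have h3 : 2 * n = (a ^ 2 - b ^ 2) * A' ^ 2 * ((c ^ 2 + e ^ 2) * B' ^ 2) := by linarith
    by_cases hab : 2 ∣ a + b
    · obtain ⟨t, ht⟩ := sixteen_dvd_of_dvd_add hac hbe hab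
      have : 2 * n = 16 * (t * (A' ^ 2 * B' ^ 2)) := by
        rw [h3]; linear_combination A' ^ 2 * B' ^ 2 * ht
      omega
    · have h4 : 2 ∣ A' * B' := by
        have h5 : 2 ∣ (a ^ 2 - b ^ 2) * A' ^ 2 * ((c ^ 2 + e ^ 2) * B' ^ 2) := ⟨n, h3.symm⟩
        rcases h2.dvd_or_dvd h5 with h | h <;> rcases h2.dvd_or_dvd h with h | h
        · exact absurd (dvd_add_of_dvd_sq_sub_sq h) hab
        · exact (h2.dvd_of_dvd_pow h).mul_right _
        · have := dvd_add_of_dvd_sq_add_sq h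
          omega
        · exact (h2.dvd_of_dvd_pow h).mul_left _
      obtain ⟨t, ht⟩ := h4
      have : 2 * n = 4 * ((a ^ 2 - b ^ 2) * (c ^ 2 + e ^ 2) * t ^ 2) := by
        rw [h3]; linear_combination (a ^ 2 - b ^ 2) * (c ^ 2 + e ^ 2) * (A' * B' + 2 * t) * ht
      omega
  have hA : Odd A := Int.odd_iff.2 (by have := Int.odd_iff.1 hB; omega)
  have hAB2 : Odd (A ^ 2 * B ^ 2) := hA.pow.mul hB.pow
  have hab : 2 ∣ a + b := by
    have h5 : 2 ∣ (a ^ 2 - b ^ 2) * (c ^ 2 + e ^ 2) * (A ^ 2 * B ^ 2) :=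
      ⟨2 ^ 4 * n, by linear_combination -hd⟩
    rcases h2.dvd_or_dvd h5 with h | h
    · rcases h2.dvd_or_dvd h with h | h
      · exact dvd_add_of_dvd_sq_sub_sq h
      · have := dvd_add_of_dvd_sq_add_sq h
        omega
    · have := Int.odd_iff.1 hAB2
      omega
  refine ⟨hB, ?_⟩
  have hq {r s : ℤ} (hr : Odd r) (hs : Odd s) : ∃ q, Odd q ∧ 2 * q = r ^ 2 + s ^ 2 := by
    have h3 := Int.eight_dvd_sq_sub_one_of_odd hr
    have h4 := Int.eight_dvd_sq_sub_one_of_odd hs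
    exact ⟨(r ^ 2 + s ^ 2) / 2, Int.odd_iff.2 (by omega), by omega⟩
  rcases Int.even_or_odd a with ha | ha
  · obtain ⟨a', rfl⟩ := ha.two_dvd
    obtain ⟨b', rfl⟩ : 2 ∣ b := by omega
    obtain ⟨r, rfl⟩ : 2 ∣ c := by omega
    obtain ⟨s, rfl⟩ : 2 ∣ e := by omega
    have h3 : 2 * n = (a' ^ 2 - b' ^ 2) * (r ^ 2 + s ^ 2) * (A ^ 2 * B ^ 2) := by linarith
    have h4 : ¬ 2 ∣ a' ^ 2 - b' ^ 2 := fun h => by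
      obtain ⟨t, ht⟩ := four_dvd_sq_sub_sq h
      have : 2 * n = 4 * (t * (r ^ 2 + s ^ 2) * (A ^ 2 * B ^ 2)) := by rw [h3, ht]; ring
      omega
    have h5 : 2 ∣ r + s := by
      have h5 : 2 ∣ (a' ^ 2 - b' ^ 2) * (r ^ 2 + s ^ 2) * (A ^ 2 * B ^ 2) := ⟨n, h3.symm⟩
      rcases h2.dvd_or_dvd h5 with h | h
      · rcases h2.dvd_or_dvd h with h | h
        · exact absurd h h4
        · exact dvd_add_of_dvd_sq_add_sq h
      · have := Int.odd_iff.1 hAB2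
        omega
    have hr : Odd r := by
      by_contra hr
      obtain ⟨r', rfl⟩ := (Int.not_odd_iff_even.1 hr).two_dvd
      obtain ⟨s', rfl⟩ : 2 ∣ s := by omega
      have : 2 * n = 4 * ((a' ^ 2 - b' ^ 2) * (r' ^ 2 + s' ^ 2) * (A ^ 2 * B ^ 2)) := by
        rw [h3]; ring
      omega
    have hs : Odd s := Int.odd_iff.2 (by have := Int.odd_iff.1 hr; omega)
    obtain ⟨q, -, hq'⟩ := hq hr hs
    refine ⟨r, s, q, hr, hs, hq', ⟨(a' ^ 2 - b' ^ 2) * A ^ 2, ?_⟩, .inr ⟨rfl, rfl⟩⟩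
    rw [← hq'] at h3
    linarith
  · have h1 := Int.odd_iff.1 ha
    have hc : Odd c := Int.odd_iff.2 (by omega)
    have he : Odd e := Int.odd_iff.2 (by omega)
    obtain ⟨q, hqo, hq'⟩ := hq hc he
    obtain ⟨w, hw⟩ := eight_dvd_sq_sub_sq ha (Int.odd_iff.2 (by omega) : Odd b)
    have h3 : 2 * n = w * (q * (A ^ 2 * B ^ 2)) := by
      rw [hw, ← hq'] at hd
      linarith
    have h4 : 2 ∣ w := by
      rcases h2.dvd_or_dvd (Dvd.intro n h3 : 2 ∣ w * (q * (A ^ 2 * B ^ 2))) with h | h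
      · exact h
      · have := Int.odd_iff.1 (hqo.mul hAB2)
        omega
    obtain ⟨w', rfl⟩ := h4
    exact ⟨c, e, q, hc, he, hq', ⟨w' * A ^ 2, by linarith⟩, .inl ⟨rfl, rfl⟩⟩

theorem sq_add_one_le_two_mul_two_pow {n : ℕ} (hn : 5 ≤ n) : n ^ 2 + 1 ≤ 2 * 2 ^ (n - 1) := by
  rw [← pow_succ', Nat.sub_add_cancel (by omega)]
  induction n, hn using Nat.le_induction with
  | base => norm_num
  | succ n hn ih =>
    rw [pow_succ 2 n]
    nlinarith

/-- The lower bound: were `B ^ 2` small, one of the two squares would be divisible by `p`. -/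
theorem sq_add_one_le_of_dvd {c e B q r s : ℤ} (hp : p ≠ 2) (hB : Odd B)
    (hr : Odd r) (hs : Odd s) (hq : 2 * q = r ^ 2 + s ^ 2)
    (hce : (c = r ∧ e = s) ∨ (c = 2 * r ∧ e = 2 * s))
    (h : (p : ℤ) ∣ c ∨ (p : ℤ) ∣ e ∨ 2 ^ (p - 1) ≤ B ^ 2) : (p : ℤ) ^ 2 + 1 ≤ 2 * (q * B ^ 2) := by
  have hpr : Prime (p : ℤ) := Nat.prime_iff_prime_int.1 Fact.out
  have hp3 : 3 ≤ p := by
    have := (Fact.out : p.Prime).two_le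
    omega
  have hone {x : ℤ} (hx : Odd x) : 1 ≤ x ^ 2 := by
    have h0 : x ≠ 0 := by
      rintro rfl
      simp at hx
    have : 0 < x ^ 2 := by positivity
    omega
  have hr1 := hone hr
  have hs1 := hone hs
  have hB1 := hone hB
  have hp2 : ¬ (p : ℤ) ∣ 2 := fun h => by
    have := Int.le_of_dvd two_pos h
    omega
  have hle {x : ℤ} (hx : 1 ≤ x ^ 2) (h : (p : ℤ) ∣ x) : (p : ℤ) ^ 2 ≤ x ^ 2 :=
    Int.le_of_dvd hx (pow_dvd_pow_of_dvd h 2)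
  have hmain : (p : ℤ) ∣ r ∨ (p : ℤ) ∣ s ∨ 2 ^ (p - 1) ≤ B ^ 2 := by
    rcases hce with ⟨rfl, rfl⟩ | ⟨rfl, rfl⟩
    · exact h
    · simpa [hpr.dvd_mul, hp2] using h
  rcases hmain with h | h | h
  · have := hle hr1 h
    nlinarith
  · have := hle hs1 h
    nlinarith
  · have : (p : ℤ) ^ 2 + 1 ≤ 2 * B ^ 2 := by
      rcases Nat.lt_or_ge p 5 with hp5 | hp5
      · obtain rfl : p = 3 := by
          have : p ≠ 4 := by rintro rfl; exact absurd (Fact.out : Nat.Prime 4) (by norm_num)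
          omega
        have := Int.eight_dvd_sq_sub_one_of_odd hB
        norm_num at h ⊢
        omega
      · have := sq_add_one_le_two_mul_two_pow hp5
        have h2 : (p : ℤ) ^ 2 + 1 ≤ 2 * 2 ^ (p - 1) := by exact_mod_cast this
        linarith
    nlinarith

theorem odd_and_not_dvd_of_gcd {m : ℤ} (hm : Int.gcd m (2 * p) = 1) :
    Odd m ∧ ¬ (p : ℤ) ∣ m := by
  have h := Int.isCoprime_iff_gcd_eq_one.2 hm
  have h2 : IsCoprime m 2 := h.of_mul_right_left
  have hp : IsCoprime m p := h.of_mul_right_right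
  refine ⟨Int.isCoprime_two_right.1 h2, fun hd => ?_⟩
  have := hp.symm.isUnit_of_dvd hd
  exact (Nat.prime_iff_prime_int.1 (Fact.out : p.Prime)).not_isUnit this

theorem dvd_and_dvd_of_dvd_sq_add_sq (hp4 : p % 4 = 3) {c e : ℤ} (h : (p : ℤ) ∣ c ^ 2 + e ^ 2) :
    (p : ℤ) ∣ c ∧ (p : ℤ) ∣ e := by
  have h0 : (c : ZMod p) ^ 2 = -(e : ZMod p) ^ 2 := by
    rw [← ZMod.intCast_zmod_eq_zero_iff_dvd] at h
    push_cast at h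
    exact eq_neg_of_add_eq_zero_left h
  have he : (e : ZMod p) = 0 := by
    by_contra he
    exact ZMod.mod_four_ne_three_of_sq_eq_neg_sq' he h0 hp4
  rw [he] at h0
  have hc : (c : ZMod p) = 0 := by simpa using h0
  exact ⟨(ZMod.intCast_zmod_eq_zero_iff_dvd _ _).1 hc, (ZMod.intCast_zmod_eq_zero_iff_dvd _ _).1 he⟩

/-- A prime `p ≡ 3 mod 4` divides the factor `(c ^ 2 + e ^ 2) * B ^ 2` to an even power, which is
at least `4` if it is not zero, and divides the other factor at least to the power `3` if at all. -/
theorem not_dvd_sq_add_sq (hp : p ≠ 2) (hp4 : p % 4 = 3) {a b c e A B m : ℤ} {l : ℕ}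
    (hl : l = 3 ∨ l = 5) (hm : ¬ (p : ℤ) ∣ m)
    (hA : (p : ℤ) ∣ A ↔ (p : ℤ) ∣ a ^ 2 - b ^ 2) (hB : (p : ℤ) ∣ B ↔ (p : ℤ) ∣ c ^ 2 + e ^ 2)
    (hd : 2 ^ 5 * (p : ℤ) ^ l * m = (a ^ 2 - b ^ 2) * A ^ 2 * ((c ^ 2 + e ^ 2) * B ^ 2)) :
    ¬ (p : ℤ) ∣ c ^ 2 + e ^ 2 := by
  intro h
  have hpr : Prime (p : ℤ) := Nat.prime_iff_prime_int.1 Fact.out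
  have hp0 := hpr.ne_zero
  have hm' : ¬ (p : ℤ) ∣ 2 ^ 5 * m := fun h => by
    rcases hpr.dvd_or_dvd h with h | h
    · have h2 := hpr.dvd_of_dvd_pow h
      have := (Nat.prime_dvd_prime_iff_eq (Fact.out : p.Prime) Nat.prime_two).1
        (by exact_mod_cast h2)
      exact hp this
    · exact hm h
  obtain ⟨B', rfl⟩ := hB.2 h
  obtain ⟨⟨c', rfl⟩, ⟨e', rfl⟩⟩ := dvd_and_dvd_of_dvd_sq_add_sq hp4 h
  have hcancel (j : ℕ) (hj : l < j) (t : ℤ) : 2 ^ 5 * (p : ℤ) ^ l * m ≠ p ^ j * t := fun h => by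
    obtain ⟨i, rfl⟩ := Nat.exists_eq_add_of_lt hj
    refine hm' ⟨p ^ i * t, mul_left_cancel₀ (pow_ne_zero l hp0) ?_⟩
    rw [pow_succ, pow_add] at h
    linear_combination h
  by_cases h1 : (p : ℤ) ∣ a ^ 2 - b ^ 2
  · obtain ⟨A', rfl⟩ := hA.2 h1
    obtain ⟨w, hw⟩ := h1
    rw [hw] at hd
    exact hcancel 7 (by omega) (w * A' ^ 2 * ((c' ^ 2 + e' ^ 2) * B' ^ 2)) (by rw [hd]; ring)
  · have h2 : ¬ (p : ℤ) ∣ (a ^ 2 - b ^ 2) * A ^ 2 := fun h => by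
      rcases hpr.dvd_or_dvd h with h | h
      · exact h1 h
      · exact h1 (hA.1 (hpr.dvd_of_dvd_pow h))
    have hd' : 2 ^ 5 * (p : ℤ) ^ l * m =
        p ^ 4 * ((a ^ 2 - b ^ 2) * A ^ 2 * ((c' ^ 2 + e' ^ 2) * B' ^ 2)) := by rw [hd]; ring
    rcases hl with rfl | rfl
    · exact hcancel 4 (by omega) _ hd'
    · have h3 : (p : ℤ) ∣ (a ^ 2 - b ^ 2) * A ^ 2 * ((c' ^ 2 + e' ^ 2) * B' ^ 2) :=
        ⟨2 ^ 5 * m, mul_left_cancel₀ (pow_ne_zero 4 hp0) (by linear_combination -hd')⟩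
      rcases hpr.dvd_or_dvd ((hpr.dvd_or_dvd h3).resolve_left h2) with h4 | h4
      · obtain ⟨⟨c'', rfl⟩, ⟨e'', rfl⟩⟩ := dvd_and_dvd_of_dvd_sq_add_sq hp4 h4
        exact hcancel 6 (by omega) ((a ^ 2 - b ^ 2) * A ^ 2 * ((c'' ^ 2 + e'' ^ 2) * B' ^ 2))
          (by rw [hd']; ring)
      · obtain ⟨B'', rfl⟩ := hpr.dvd_of_dvd_pow h4
        exact hcancel 6 (by omega) ((a ^ 2 - b ^ 2) * A ^ 2 * ((c' ^ 2 + e' ^ 2) * B'' ^ 2))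
          (by rw [hd']; ring)

/-- In these cases `p` does not divide `c ^ 2 + e ^ 2`, so the lower bound for the divisor `q * B ^
2` of `p ^ l * m` is one for `m`. -/
theorem le_natAbs_of_mem (hp : p ≠ 2) {l : ℕ} {m : ℤ} (hm : Int.gcd m (2 * p) = 1)
    (hd : 2 ^ 5 * (p : ℤ) ^ l * m ∈ dicyclicDeterminants p)
    (hl : l = 0 ∨ (p % 4 = 3 ∧ (l = 3 ∨ l = 5))) : (p ^ 2 + 1) / 2 ≤ m.natAbs := by
  obtain ⟨a, b, c, e, A, B, hac, hbe, hAB, hA, hB, hsmall, hd⟩ := exists_factorization hp hd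
  obtain ⟨hmo, hmp⟩ := odd_and_not_dvd_of_gcd hm
  have hpr : Prime (p : ℤ) := Nat.prime_iff_prime_int.1 Fact.out
  have hpo : Odd (p : ℤ) := by exact_mod_cast (Fact.out : p.Prime).odd_of_ne_two hp
  have hce : ¬ (p : ℤ) ∣ c ^ 2 + e ^ 2 := by
    rcases hl with rfl | ⟨hp4, hl⟩
    · intro h
      have h2 : (p : ℤ) ∣ 2 ^ 5 * (p : ℤ) ^ 0 * m := by
        rw [hd]; exact (h.mul_right _).mul_left _
      rw [pow_zero, mul_one] at h2
      rcases hpr.dvd_or_dvd h2 with h | h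
      · have := (Nat.prime_dvd_prime_iff_eq (Fact.out : p.Prime) Nat.prime_two).1
          (by exact_mod_cast hpr.dvd_of_dvd_pow h)
        exact hp this
      · exact hmp h
    · exact not_dvd_sq_add_sq hp hp4 hl hmp hA hB hd
  obtain ⟨hBo, r, s, q, hr, hs, hq, hdvd, h⟩ :=
    exists_odd_sq_add_sq hac hbe hAB (hpo.pow.mul hmo) (by rw [← hd, mul_assoc])
  have hqce : q ∣ c ^ 2 + e ^ 2 := by
    rcases h with ⟨rfl, rfl⟩ | ⟨rfl, rfl⟩
    · exact ⟨2, by linarith⟩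
    · exact ⟨8, by linarith⟩
  have hcop : IsCoprime (q * B ^ 2) ((p : ℤ) ^ l) := by
    refine (IsCoprime.pow_left ((hpr.coprime_iff_not_dvd).2 fun h => ?_)).symm
    rcases hpr.dvd_or_dvd h with h | h
    · exact hce (h.trans hqce)
    · exact hce (hB.1 (hpr.dvd_of_dvd_pow h))
  have hle := sq_add_one_le_of_dvd hp hBo hr hs hq h hsmall
  have hm0 : m ≠ 0 := by rintro rfl; simp at hmo
  have h1 : q * B ^ 2 ≤ |m| := Int.le_of_dvd (abs_pos.2 hm0)
    ((dvd_abs _ _).2 (hcop.dvd_of_dvd_mul_left hdvd))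
  have h2 : (p : ℤ) ^ 2 + 1 ≤ 2 * (m.natAbs : ℤ) := by
    rw [Int.natCast_natAbs]; linarith
  have h3 : p ^ 2 + 1 ≤ 2 * m.natAbs := by exact_mod_cast h2
  omega

theorem exists_eq_two_pow_mul {d : ℤ} (hd : d ≠ 0) :
    ∃ (k l : ℕ) (m : ℤ), d = 2 ^ k * (p : ℤ) ^ l * m ∧ Int.gcd m (2 * p) = 1 := by
  have hpr : Prime (p : ℤ) := Nat.prime_iff_prime_int.1 Fact.out
  have hp1 : (p : ℤ).natAbs ≠ 1 := (Fact.out : p.Prime).ne_one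
  obtain ⟨c, hc, hc2⟩ :=
    (Int.finiteMultiplicity_iff (a := 2).2 ⟨by norm_num, hd⟩).exists_eq_pow_mul_and_not_dvd
  have hc0 : c ≠ 0 := by rintro rfl; simp at hc2
  obtain ⟨m, hm, hmp⟩ :=
    (Int.finiteMultiplicity_iff (a := p).2 ⟨hp1, hc0⟩).exists_eq_pow_mul_and_not_dvd
  refine ⟨multiplicity 2 d, multiplicity (p : ℤ) c, m, ?_, ?_⟩
  · rw [mul_assoc, ← hm, ← hc]
  · rw [← Int.isCoprime_iff_gcd_eq_one]
    refine IsCoprime.mul_right ?_ ((hpr.coprime_iff_not_dvd).2 hmp).symm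
    refine ((Int.prime_two.coprime_iff_not_dvd).2 fun h => hc2 ?_).symm
    rw [hm]
    exact h.mul_left _

theorem form_of_mem (hp : p ≠ 2) {d : ℤ} (hd : d ∈ dicyclicDeterminants p) (h0 : d ≠ 0) :
    ∃ (k l : ℕ) (m : ℤ), d = 2 ^ k * (p : ℤ) ^ l * m ∧ Int.gcd m (2 * p) = 1 ∧
        (k = 0 ∨ 4 ≤ k) ∧ (l = 0 ∨ 3 ≤ l) := by
  obtain ⟨k, l, m, hdm, hm⟩ := exists_eq_two_pow_mul (p := p) h0
  refine ⟨k, l, m, hdm, hm, ?_, ?_⟩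
  all_goals
    obtain ⟨a, b, c, e, A, B, hac, hbe, hAB, hA, hB, -, hd⟩ := exists_factorization hp hd
    obtain ⟨hmo, hmp⟩ := odd_and_not_dvd_of_gcd hm
    have hpr : Prime (p : ℤ) := Nat.prime_iff_prime_int.1 Fact.out
    have hpo : Odd (p : ℤ) := by exact_mod_cast (Fact.out : p.Prime).odd_of_ne_two hp
    refine or_iff_not_imp_left.2 fun hne => ?_
  · have h16 : (2 : ℤ) ^ 4 ∣ d := by
      have h2 : 2 ∣ d := by rw [hdm, mul_assoc]; exact (dvd_pow_self 2 hne).mul_right _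
      exact sixteen_dvd_of_two_dvd hac hbe hAB hd h2
    rw [hdm, mul_assoc] at h16
    have hcop : IsCoprime ((2 : ℤ) ^ 4) (p ^ l * m) :=
      (Int.isCoprime_two_left.2 (hpo.pow.mul hmo)).pow_left
    exact (pow_dvd_pow_iff two_ne_zero Int.prime_two.not_isUnit).1 (hcop.dvd_of_dvd_mul_right h16)
  · have h3 : (p : ℤ) ^ 3 ∣ d := by
      have h1 : (p : ℤ) ∣ d := by
        rw [hdm]; exact ((dvd_pow_self _ hne).mul_left _).mul_right _
      have hA3 (h : (p : ℤ) ∣ a ^ 2 - b ^ 2) : (p : ℤ) ^ 3 ∣ d := by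
        obtain ⟨A', rfl⟩ := hA.2 h
        obtain ⟨w, hw⟩ := h
        exact ⟨w * A' ^ 2 * ((c ^ 2 + e ^ 2) * B ^ 2), by rw [hd, hw]; ring⟩
      have hB3 (h : (p : ℤ) ∣ c ^ 2 + e ^ 2) : (p : ℤ) ^ 3 ∣ d := by
        obtain ⟨B', rfl⟩ := hB.2 h
        obtain ⟨w, hw⟩ := h
        exact ⟨(a ^ 2 - b ^ 2) * A ^ 2 * (w * B' ^ 2), by rw [hd, hw]; ring⟩
      rw [hd] at h1
      rcases hpr.dvd_or_dvd h1 with h | h <;> rcases hpr.dvd_or_dvd h with h | h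
      · exact hA3 h
      · exact hA3 (hA.1 (hpr.dvd_of_dvd_pow h))
      · exact hB3 h
      · exact hB3 (hB.1 (hpr.dvd_of_dvd_pow h))
    have hp2 : ¬ (p : ℤ) ∣ 2 ^ k := fun h => hp ((Nat.prime_dvd_prime_iff_eq
      (Fact.out : p.Prime) Nat.prime_two).1 (by exact_mod_cast hpr.dvd_of_dvd_pow h))
    have hcop : IsCoprime ((p : ℤ) ^ 3) (2 ^ k * m) := by
      refine ((hpr.coprime_iff_not_dvd).2 fun h => ?_).pow_left
      exact (hpr.dvd_or_dvd h).elim hp2 hmp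
    rw [hdm, mul_right_comm] at h3
    exact (pow_dvd_pow_iff hpr.ne_zero hpr.not_isUnit).1 (hcop.dvd_of_dvd_mul_left h3)

end Necessary

/-! ### Cyclotomic units -/

section Units
variable {p : ℕ} [Fact p.Prime]

/-- The element `i` of `C_p`, as an element of `ℤ[C_p]`. -/
noncomputable def cyc (i : ZMod p) : ℤ[ZMod p] := .single i 1

theorem cyc_mul (i j : ZMod p) : cyc i * cyc j = cyc (i + j) := by simp [cyc]

theorem cyc_zero : cyc (0 : ZMod p) = 1 := rfl

theorem cyc_pow (i : ZMod p) (n : ℕ) : cyc i ^ n = cyc (n * i : ZMod p) := by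
  simp [cyc, AddMonoidAlgebra.single_pow]

@[simp] theorem conjInv_cyc (i : ZMod p) : conjInv (cyc i) = cyc (-i) := conjInv_single i 1

@[simp] theorem aug_cyc (i : ZMod p) : aug (cyc i) = 1 := aug_single i 1

theorem evalZeta_cyc (k i : ZMod p) : evalZeta k (cyc i) = zetaChar p (k * i) := by
  simp [cyc, evalZeta_single]

variable (p) in
/-- The sum of the elements of `C_p`, which vanishes at all nontrivial characters. -/
noncomputable def sumCyc : ℤ[ZMod p] := ∑ i, cyc i

theorem evalZeta_sumCyc {k : ZMod p} (hk : k ≠ 0) : evalZeta k (sumCyc p) = 0 := by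
  have := AddChar.sum_mulShift k (zetaChar_isPrimitive (p := p))
  simp only [if_neg hk, Nat.cast_zero] at this
  simp only [sumCyc, map_sum, evalZeta_cyc, mul_comm k, this]

@[simp] theorem aug_sumCyc : aug (sumCyc p) = p := by simp [sumCyc]

@[simp] theorem conjInv_sumCyc : conjInv (sumCyc p) = sumCyc p := by
  simp only [sumCyc, map_sum, conjInv_cyc]
  exact Fintype.sum_equiv (Equiv.neg _) _ _ fun i => by simp

theorem coeff_sumCyc (i : ZMod p) : (sumCyc p).coeff i = 1 := by
  simp [sumCyc, cyc, Finsupp.single_apply]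

theorem cycNorm_add_mul_sumCyc (F H : ℤ[ZMod p]) : cycNorm (F + H * sumCyc p) = cycNorm F :=
  cycNorm_congr fun k hk => by simp [evalZeta_sumCyc hk]

/-- The endomorphism of `ℤ[C_p]` given by the `m`-th power map of `C_p`. -/
noncomputable def dilate (m : ZMod p) : ℤ[ZMod p] →+* ℤ[ZMod p] :=
  AddMonoidAlgebra.mapDomainRingHom ℤ (AddMonoidHom.mulLeft m)

@[simp] theorem dilate_single (m i : ZMod p) (n : ℤ) :
    dilate m (.single i n) = .single (m * i) n := by
  simp [dilate]

@[simp] theorem dilate_cyc (m i : ZMod p) : dilate m (cyc i) = cyc (m * i) := dilate_single m i 1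

theorem evalZeta_dilate (k m : ZMod p) (F : ℤ[ZMod p]) :
    evalZeta k (dilate m F) = evalZeta (k * m) F := by
  have : (evalZeta k).comp (dilate m) = evalZeta (k * m) :=
    AddMonoidAlgebra.ringHom_ext (by simp [evalZeta_single]) (by simp [evalZeta_single, mul_assoc])
  exact congrArg (· F) this

theorem aug_dilate (m : ZMod p) (F : ℤ[ZMod p]) : aug (dilate m F) = aug F := by
  have : aug.comp (dilate m) = aug := AddMonoidAlgebra.ringHom_ext (by simp) (by simp)
  exact congrArg (· F) this

theorem conjInv_dilate (m : ZMod p) (F : ℤ[ZMod p]) :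
    conjInv (dilate m F) = dilate m (conjInv F) := by
  have : conjInv.comp (dilate m) = (dilate m).comp conjInv :=
    AddMonoidAlgebra.ringHom_ext (by simp) (by simp)
  exact congrArg (· F) this

theorem cycNorm_dilate {m : ZMod p} (hm : m ≠ 0) (F : ℤ[ZMod p]) :
    cycNorm (dilate m F) = cycNorm F := by
  have : (cycNorm (dilate m F) : CyclotomicInt p) = (cycNorm F : ℤ) := by
    simp only [cast_cycNorm, evalZeta_dilate]
    refine Finset.prod_nbij' (fun k => k * m) (fun k => k * m⁻¹) ?_ ?_ ?_ ?_ ?_ <;> simp [hm]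
  exact_mod_cast this

theorem cycNorm_conjInv (F : ℤ[ZMod p]) : cycNorm (conjInv F) = cycNorm F := by
  rw [← cycNorm_dilate (neg_ne_zero.2 one_ne_zero) F]
  exact cycNorm_congr fun k _ => by rw [evalZeta_conjInv, evalZeta_dilate, mul_neg_one]

theorem cycNorm_cyc (hp : p ≠ 2) (i : ZMod p) : cycNorm (cyc i) = 1 := by
  have h : cycNorm (cyc i) ^ p = 1 := by
    rw [← cycNorm_pow, cyc_pow, ZMod.natCast_self, zero_mul, cyc_zero, cycNorm_one]
  exact (((Fact.out : p.Prime).odd_of_ne_two hp).pow_inj (b := 1)).1 (by rw [h, one_pow])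

theorem cycNorm_cyc_one_sub_one (hp : p ≠ 2) : cycNorm (cyc (1 : ZMod p) - 1) = p := by
  have hpr : p.Prime := Fact.out
  have hζ := (IsCyclotomicExtension.zeta_spec p ℚ
    (CyclotomicField p ℚ)).toInteger_isPrimitiveRoot
  have h1 : (cycNorm (1 - cyc (1 : ZMod p)) : CyclotomicInt p) = (p : ℤ) := by
    have hp1 : p - 1 + 1 = p := Nat.sub_add_cancel hpr.one_le
    have hprod := IsPrimitiveRoot.prod_one_sub_pow_eq_order (n := p - 1) (by rwa [hp1])
    rw [← Nat.cast_succ, Nat.succ_eq_add_one, hp1] at hprod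
    rw [cast_cycNorm, prod_erase_zero_eq, Finset.prod_Ico_eq_prod_range, Int.cast_natCast, ← hprod]
    refine Finset.prod_congr rfl fun k _ => ?_
    rw [map_sub, map_one, evalZeta_cyc, mul_one, add_comm k]
    exact congrArg (1 - ·) (AddChar.zmodChar_apply' _ _)
  rw [← cycNorm_neg hp, neg_sub]
  exact_mod_cast h1

theorem zmod_two_ne_zero (hp : p ≠ 2) : (2 : ZMod p) ≠ 0 := by
  have : Fact (2 < p) := ⟨by have := (Fact.out : p.Prime).two_le; omega⟩
  exact_mod_cast (ZMod.natCast_eq_zero_iff 2 p).not.2 (Nat.not_dvd_of_pos_of_lt two_pos this.out)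

theorem cycNorm_cyc_one_add_one (hp : p ≠ 2) : cycNorm (cyc (1 : ZMod p) + 1) = 1 := by
  have h : (cyc (1 : ZMod p) + 1) * (cyc (1 : ZMod p) - 1) = dilate 2 (cyc (1 : ZMod p) - 1) := by
    have h2 : cyc (2 : ZMod p) = cyc 1 * cyc 1 := by rw [cyc_mul, one_add_one_eq_two]
    rw [map_sub, map_one, dilate_cyc, mul_one, h2]
    ring
  have h2 := congrArg cycNorm h
  rw [cycNorm_mul, cycNorm_dilate (zmod_two_ne_zero hp), cycNorm_cyc_one_sub_one hp] at h2
  have hp0 : (p : ℤ) ≠ 0 := by exact_mod_cast (Fact.out : p.Prime).ne_zero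
  exact mul_right_cancel₀ hp0 (by rw [h2, one_mul])

/-- The symmetric geometric sum `∑ (ε x) ^ i / x ^ n` over `0 ≤ i ≤ 2 n`. -/
noncomputable def geomCyc (p : ℕ) (ε : ℤ) (n : ℕ) : ℤ[ZMod p] :=
  cyc (-n : ZMod p) * ∑ i ∈ Finset.range (2 * n + 1), ((ε : ℤ[ZMod p]) * cyc 1) ^ i

theorem conjInv_geomCyc {ε : ℤ} (hε : ε ^ 2 = 1) (n : ℕ) :
    conjInv (geomCyc p ε n) = geomCyc p ε n := by
  simp only [geomCyc, map_mul, map_sum, map_pow, map_intCast, conjInv_cyc, neg_neg]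
  rw [Finset.mul_sum, Finset.mul_sum, ← Finset.sum_range_reflect]
  refine Finset.sum_congr rfl fun i hi => ?_
  rw [Finset.mem_range] at hi
  obtain ⟨j, hj⟩ : ∃ j, 2 * n + 1 - 1 - i = j := ⟨_, rfl⟩
  rw [hj, mul_pow, mul_pow, cyc_pow, cyc_pow, mul_left_comm, mul_left_comm (cyc _), cyc_mul,
    cyc_mul]
  have hji : i + j = 2 * n := by omega
  congr 1
  · have h : (ε : ℤ[ZMod p]) ^ 2 = 1 := by
      exact_mod_cast congrArg (Int.cast : ℤ → ℤ[ZMod p]) hε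
    have h2 : (ε : ℤ[ZMod p]) ^ (i + j) = 1 := by rw [hji, pow_mul, h, one_pow]
    have h3 : (ε : ℤ[ZMod p]) ^ (2 * j) = 1 := by rw [pow_mul, h, one_pow]
    rw [two_mul, pow_add] at h3
    rw [pow_add] at h2
    linear_combination (ε : ℤ[ZMod p]) ^ i * h3 - (ε : ℤ[ZMod p]) ^ j * h2
  · congr 1
    have : ((i + j : ℕ) : ZMod p) = ((2 * n : ℕ) : ZMod p) := by rw [hji]
    push_cast at this
    linear_combination (-1 : ZMod p) * this

/-- So `geomCyc p ε n` is a quotient of conjugate elements, up to a group element. -/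
theorem geomCyc_mul {ε : ℤ} (hε : ε ^ 2 = 1) (n : ℕ) :
    geomCyc p ε n * ((ε : ℤ[ZMod p]) * cyc 1 - 1) =
      cyc (-n : ZMod p) * dilate (2 * n + 1 : ZMod p) ((ε : ℤ[ZMod p]) * cyc 1 - 1) := by
  have h : (ε : ℤ[ZMod p]) ^ 2 = 1 := by exact_mod_cast congrArg (Int.cast : ℤ → ℤ[ZMod p]) hε
  rw [geomCyc, mul_assoc, geom_sum_mul, mul_pow, cyc_pow, pow_succ, pow_mul, h, one_pow]
  simp

theorem cycNorm_geomCyc (hp : p ≠ 2) {ε : ℤ} (hε : ε = 1 ∨ ε = -1) {n : ℕ}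
    (hn : (2 * n + 1 : ZMod p) ≠ 0) : cycNorm (geomCyc p ε n) = 1 := by
  have h0 : cycNorm ((ε : ℤ[ZMod p]) * cyc 1 - 1) ≠ 0 := by
    rcases hε with rfl | rfl
    · simp only [Int.cast_one, one_mul, cycNorm_cyc_one_sub_one hp]
      exact_mod_cast (Fact.out : p.Prime).ne_zero
    · rw [← cycNorm_neg hp,
        show -(((-1 : ℤ) : ℤ[ZMod p]) * cyc 1 - 1) = cyc 1 + 1 by push_cast; ring,
        cycNorm_cyc_one_add_one hp]
      exact one_ne_zero
  have hε2 : ε ^ 2 = 1 := by rcases hε with rfl | rfl <;> norm_num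
  have h := congrArg cycNorm (geomCyc_mul (p := p) hε2 n)
  rw [cycNorm_mul, cycNorm_mul, cycNorm_cyc hp, cycNorm_dilate hn] at h
  exact mul_right_cancel₀ h0 h

theorem aug_geomCyc_one (n : ℕ) : aug (geomCyc p 1 n) = 2 * n + 1 := by
  simp [geomCyc]

theorem aug_geomCyc_neg_one (n : ℕ) : aug (geomCyc p (-1) n) = 1 := by
  simp [geomCyc, neg_one_geom_sum]

theorem two_dvd_geomCyc_sub (n : ℕ) : 2 ∣ geomCyc p (-1) n - geomCyc p 1 n := by
  rw [geomCyc, geomCyc, ← mul_sub, ← Finset.sum_sub_distrib]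
  refine Dvd.dvd.mul_left (Finset.dvd_sum fun i _ => ?_) _
  refine dvd_trans ⟨-cyc 1, ?_⟩ (sub_dvd_pow_sub_pow _ _ i)
  push_cast
  ring

/-- The annihilator of `x - 1` in `ℤ[C_p]` is spanned by the sum of `C_p`. -/
theorem exists_eq_mul_sumCyc {F : ℤ[ZMod p]} (h : F * (cyc 1 - 1) = 0) :
    ∃ c : ℤ, F = c * sumCyc p := by
  have h1 : ∀ i : ZMod p, F.coeff (i + 1) = F.coeff i := by
    intro i
    have h2 : F * cyc 1 = F := by linear_combination h
    have h3 : (F * cyc 1).coeff (i + 1) = F.coeff i * 1 :=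
      AddMonoidAlgebra.coeff_mul_single_eq_coeff_mul _ (by simp)
    rw [← h2, h3, mul_one, h2]
  have h2 : ∀ n : ℕ, F.coeff (n : ZMod p) = F.coeff 0 := by
    intro n
    induction n with
    | zero => simp
    | succ n ih => rw [Nat.cast_succ, h1, ih]
  refine ⟨F.coeff 0, ?_⟩
  ext i
  have h3 := h2 i.val
  rw [ZMod.natCast_zmod_val] at h3
  rw [h3, ← zsmul_eq_mul, AddMonoidAlgebra.coeff_smul, Finsupp.smul_apply, coeff_sumCyc,
    smul_eq_mul, mul_one]

theorem exists_nat_two_mul_add_one (hp : p ≠ 2) (r : ZMod p) :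
    ∃ n : ℕ, (2 * n + 1 : ZMod p) = r := by
  refine ⟨((r - 1) / 2).val, ?_⟩
  rw [ZMod.natCast_zmod_val, mul_div_cancel₀ _ (zmod_two_ne_zero hp), sub_add_cancel]

/-- Every nonzero residue modulo `p` is the augmentation of a symmetric cyclotomic unit that is
congruent to `1` modulo `2`. -/
theorem exists_unit_congr_one (hp : p ≠ 2) {r : ZMod p} (hr : r ≠ 0) :
    ∃ η : ℤ[ZMod p], conjInv η = η ∧ cycNorm η = 1 ∧ 2 ∣ η - 1 ∧ (aug η : ZMod p) = r := by
  obtain ⟨n', hn'⟩ := exists_nat_two_mul_add_one hp r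
  obtain ⟨n, hn⟩ := exists_nat_two_mul_add_one hp r⁻¹
  have hn0 : (2 * n + 1 : ZMod p) ≠ 0 := by rw [hn]; exact inv_ne_zero hr
  have hn0' : (2 * n' + 1 : ZMod p) ≠ 0 := by rwa [hn']
  refine ⟨geomCyc p (-1) n * dilate (2 * n + 1 : ZMod p) (geomCyc p 1 n'), ?_, ?_, ?_, ?_⟩
  · rw [map_mul, conjInv_geomCyc (by norm_num), conjInv_dilate, conjInv_geomCyc (by norm_num)]
  · rw [cycNorm_mul, cycNorm_dilate hn0, cycNorm_geomCyc hp (.inr rfl) hn0,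
      cycNorm_geomCyc hp (.inl rfl) hn0', one_mul]
  · -- Without the sign, the product telescopes to `1` away from the trivial character; the sign
    -- does not matter modulo `2`, but keeps the first augmentation equal to `1`.
    have h1 : (geomCyc p 1 n * dilate (2 * n + 1 : ZMod p) (geomCyc p 1 n') - 1) *
        (cyc 1 - 1) = 0 := by
      have h2 := geomCyc_mul (p := p) (ε := 1) (by norm_num) n
      have h3 := congrArg (dilate (2 * n + 1 : ZMod p))
        (geomCyc_mul (p := p) (ε := 1) (by norm_num) n')
      simp only [Int.cast_one, one_mul, map_mul, map_sub, map_one, dilate_cyc, mul_one] at h2 h3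
      have h4 : (2 * n + 1 : ZMod p) * (2 * n' + 1) = 1 := by rw [hn, hn', inv_mul_cancel₀ hr]
      have h5 : (-n : ZMod p) + (2 * n + 1) * -n' = 0 := by
        refine mul_left_cancel₀ (zmod_two_ne_zero hp) ?_
        linear_combination -h4
      rw [h4] at h3
      have h6 : cyc (-n : ZMod p) * cyc ((2 * n + 1) * -n' : ZMod p) = 1 := by
        rw [cyc_mul, h5, cyc_zero]
      linear_combination dilate (2 * n + 1 : ZMod p) (geomCyc p 1 n') * h2 +
        cyc (-n : ZMod p) * h3 + (cyc 1 - 1) * h6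
    obtain ⟨c, hc⟩ := exists_eq_mul_sumCyc h1
    have h2 := congrArg aug hc
    simp only [map_sub, map_mul, map_one, aug_dilate, aug_geomCyc_one, map_intCast, aug_sumCyc,
      Int.cast_id] at h2
    have hpo : Odd (p : ℤ) := by exact_mod_cast (Fact.out : p.Prime).odd_of_ne_two hp
    have h3 : 2 ∣ c * (p : ℤ) := ⟨2 * n * n' + n + n', by rw [← h2]; ring⟩
    obtain ⟨w, rfl⟩ : 2 ∣ c := (Int.prime_two.dvd_or_dvd h3).resolve_right fun h => by
      have := Int.odd_iff.1 hpo
      omega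
    obtain ⟨v, hv⟩ := two_dvd_geomCyc_sub (p := p) n
    refine ⟨v * dilate (2 * n + 1 : ZMod p) (geomCyc p 1 n') + w * sumCyc p, ?_⟩
    push_cast at hc
    linear_combination hc + dilate (2 * n + 1 : ZMod p) (geomCyc p 1 n') * hv
  · rw [map_mul, aug_dilate, aug_geomCyc_one, aug_geomCyc_neg_one, one_mul, ← hn']
    push_cast
    rfl

/-- A symmetric cyclotomic unit `E` can be changed, modulo `2`, only at the trivial character, to a
symmetric unit with any prescribed augmentation prime to `p` and of the right parity. -/
theorem exists_unit_aug_eq (hp : p ≠ 2) {E : ℤ[ZMod p]} (hE : conjInv E = E) (hE1 : cycNorm E = 1)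
    {n s : ℤ} (hEp : ¬ (p : ℤ) ∣ aug E) (hn : ¬ (p : ℤ) ∣ n) (hs : 2 ∣ n - aug E - s) :
    ∃ P : ℤ[ZMod p], conjInv P = P ∧ cycNorm P = 1 ∧ aug P = n ∧ 2 ∣ P - E - s * sumCyc p := by
  rw [← ZMod.intCast_zmod_eq_zero_iff_dvd] at hEp hn
  obtain ⟨η, h1, h2, ⟨u, h3⟩, h4⟩ := exists_unit_congr_one hp (div_ne_zero hn hEp)
  have h5 : (p : ℤ) ∣ n - aug E * aug η := by
    rw [← ZMod.intCast_zmod_eq_zero_iff_dvd]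
    push_cast
    rw [h4, mul_div_cancel₀ _ hEp, sub_self]
  obtain ⟨c, hc⟩ := h5
  have hpo : Odd (p : ℤ) := by exact_mod_cast (Fact.out : p.Prime).odd_of_ne_two hp
  have h6 : 2 ∣ c - s := by
    obtain ⟨q, hq⟩ := hpo
    obtain ⟨v, hv⟩ := hs
    have h7 := congrArg aug h3
    simp only [map_sub, map_mul, map_one, map_ofNat aug 2] at h7
    exact ⟨v - aug E * aug u - c * q, by rw [hq] at hc; linear_combination -hc + hv - aug E * h7⟩
  obtain ⟨v, hv⟩ := h6
  refine ⟨E * η + c * sumCyc p, ?_, ?_, ?_, E * u + v * sumCyc p, ?_⟩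
  · simp [hE, h1]
  · rw [cycNorm_add_mul_sumCyc, cycNorm_mul, hE1, h2, one_mul]
  · simp only [map_add, map_mul, map_intCast, aug_sumCyc, Int.cast_id]
    linear_combination -hc
  · have hv' := congrArg (Int.cast : ℤ → ℤ[ZMod p]) hv
    push_cast at hv'
    linear_combination E * h3 + sumCyc p * hv'

end Units

/-! ### Constructions -/

section Constructions
variable {p : ℕ} [Fact p.Prime]

@[simp] theorem aug_two : aug (2 : ℤ[ZMod p]) = 2 := map_ofNat aug 2

@[simp] theorem conjInv_two : conjInv (2 : ℤ[ZMod p]) = 2 := map_ofNat conjInv 2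

theorem conjInv_eq_iff {F : ℤ[ZMod p]} : conjInv F = F ↔ ∀ i, F.coeff (-i) = F.coeff i := by
  refine ⟨fun h i => by rw [← coeff_conjInv, h], fun h => ?_⟩
  ext i
  rw [coeff_conjInv, h]

/-- A symmetric element of even augmentation has an even constant coefficient, as `p` is odd. -/
theorem exists_eq_add_conjInv (hp : p ≠ 2) {F : ℤ[ZMod p]} (hF : conjInv F = F)
    (h : 2 ∣ aug F) : ∃ H, F = H + conjInv H := by
  have hF' := conjInv_eq_iff.1 hF
  have hodd : p % 2 = 1 := Nat.odd_iff.1 ((Fact.out : p.Prime).odd_of_ne_two hp)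
  let H : ℤ[ZMod p] := .ofCoeff (Finsupp.equivFunOnFinite.symm fun i =>
    if 0 < i.val ∧ i.val ≤ p / 2 then F.coeff i else 0)
  have hH : F = H + conjInv H + (F.coeff 0 : ℤ) := by
    ext i
    have hc : ((F.coeff 0 : ℤ) : ℤ[ZMod p]).coeff i = if i = 0 then F.coeff 0 else 0 := by
      simp [AddMonoidAlgebra.intCast_def, Finsupp.single_apply, eq_comm]
    rw [AddMonoidAlgebra.coeff_add, AddMonoidAlgebra.coeff_add, Finsupp.add_apply,
      Finsupp.add_apply, coeff_conjInv, hc]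
    by_cases hi : i = 0
    · subst hi
      simp [H]
    · have hv : 0 < i.val := Nat.pos_of_ne_zero fun h => hi ((ZMod.val_eq_zero i).1 h)
      have hv' := ZMod.val_lt i
      have hneg : (-i).val = p - i.val := by rw [ZMod.neg_val, if_neg hi]
      simp only [H, Finsupp.equivFunOnFinite_symm_apply_apply, hneg, hF' i, if_neg hi]
      by_cases h1 : i.val ≤ p / 2
      · rw [if_pos ⟨hv, h1⟩, if_neg (by omega), add_zero, add_zero]
      · rw [if_neg (by omega), if_pos (by omega), add_zero, zero_add]
  have ha := congrArg aug hH
  simp only [map_add, aug_conjInv, map_intCast, Int.cast_id] at ha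
  obtain ⟨j, hj⟩ : 2 ∣ F.coeff 0 := by omega
  refine ⟨H + (j : ℤ), ?_⟩
  rw [hj] at hH
  rw [map_add, map_intCast]
  push_cast at hH
  linear_combination hH

/-- With `g = G + 2 h` and `f = P - g`, where `(P - Q) / 2 = G + h + h̄`, one has
`f f̄ - g ḡ = P (P - g - ḡ) = P Q`. -/
theorem mem_of_symmetric (hp : p ≠ 2) {P Q G Y f' g' : ℤ[ZMod p]} (hP : conjInv P = P)
    (hQ : conjInv Q = Q) (hG : conjInv G = G) (hY : P - Q = 2 * Y) (hYG : 2 ∣ aug Y - aug G)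
    (hf : 2 ∣ P - G - f') (hg : 2 ∣ G - g') :
    aug P * cycNorm P * (aug Q * cycNorm Q) * (aug (f' * conjInv f' + g' * conjInv g') *
      cycNorm (f' * conjInv f' + g' * conjInv g')) ∈ dicyclicDeterminants p := by
  have hYs : conjInv Y = Y := by
    have h := congrArg conjInv hY
    rw [map_sub, hP, hQ, hY, map_mul, conjInv_two] at h
    ext i
    have := congrArg (fun F : ℤ[ZMod p] => F.coeff i) h
    simp only [two_mul, AddMonoidAlgebra.coeff_add, Finsupp.add_apply] at this
    omega
  obtain ⟨h, hh⟩ := exists_eq_add_conjInv hp (F := Y - G) (by rw [map_sub, hYs, hG])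
    (by rwa [map_sub])
  obtain ⟨u, hu⟩ := hf
  obtain ⟨v, hv⟩ := hg
  have e : (P - (G + 2 * h)) * conjInv (P - (G + 2 * h)) -
      (G + 2 * h) * conjInv (G + 2 * h) = P * Q := by
    simp only [map_sub, map_add, map_mul, conjInv_two, hP, hG]
    linear_combination P * hY + 2 * P * hh
  refine (mem_dicyclicDeterminants_iff hp).2 ⟨P - (G + 2 * h), f', G + 2 * h, g',
    ⟨u - h, by linear_combination hu⟩, ⟨v + h, by linear_combination hv⟩, ?_⟩
  rw [e, map_mul, cycNorm_mul]
  ring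

theorem neg_one_mem (hp : p ≠ 2) : -1 ∈ dicyclicDeterminants p := by
  refine (mem_dicyclicDeterminants_iff hp).2 ⟨0, 0, 1, 1, by simp, by simp, ?_⟩
  simp [cycNorm_neg hp]

theorem neg_mem_dicyclicDeterminants (hp : p ≠ 2) {d : ℤ} (hd : d ∈ dicyclicDeterminants p) :
    -d ∈ dicyclicDeterminants p := by
  simpa using mul_mem_dicyclicDeterminants (neg_one_mem hp) hd

theorem prime_not_dvd_two (hp : p ≠ 2) : ¬ (p : ℤ) ∣ 2 := fun h =>
  hp ((Nat.prime_dvd_prime_iff_eq (Fact.out : p.Prime) Nat.prime_two).1 (by exact_mod_cast h))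

theorem not_dvd_two_mul (hp : p ≠ 2) {a : ℤ} (ha : ¬ (p : ℤ) ∣ a) : ¬ (p : ℤ) ∣ 2 * a := fun h =>
  ((Nat.prime_iff_prime_int.1 (Fact.out : p.Prime)).dvd_or_dvd h).elim (prime_not_dvd_two hp) ha

theorem not_dvd_one : ¬ (p : ℤ) ∣ 1 :=
  (Nat.prime_iff_prime_int.1 (Fact.out : p.Prime)).not_dvd_one

/-- Take `P = 1` and `Q` a unit of augmentation `m`, both congruent to `1` modulo `2`. -/
theorem mem_of_odd_of_not_dvd (hp : p ≠ 2) {m : ℤ} (hm : Odd m) (hmp : ¬ (p : ℤ) ∣ m) :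
    m ∈ dicyclicDeterminants p := by
  have key {n : ℤ} (hn : 4 ∣ n - 1) (hnp : ¬ (p : ℤ) ∣ n) : n ∈ dicyclicDeterminants p := by
    obtain ⟨Q, hQ, hQ1, hQa, ⟨w, hw⟩⟩ := exists_unit_aug_eq hp (E := 1) (n := n) (s := 0) (by simp)
      (by simp) (by simpa using not_dvd_one) hnp (by simp; omega)
    push_cast at hw
    have hwa := congrArg aug hw
    simp only [map_sub, map_mul, map_one, hQa, aug_two, zero_mul, sub_zero] at hwa
    have := mem_of_symmetric hp (P := 1) (Q := Q) (G := 0) (Y := -w) (f' := 1) (g' := 0) (by simp)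
      hQ (by simp) (by linear_combination -hw) (by simp; omega) (by simp) (by simp)
    simpa [hQ1, hQa] using this
  have := Int.odd_iff.1 hm
  rcases (by omega : 4 ∣ m - 1 ∨ 4 ∣ -m - 1) with h | h
  · exact key h hmp
  · rw [← neg_neg m]
    exact neg_mem_dicyclicDeterminants hp (key h (by rwa [Int.dvd_neg]))

/-- The symmetric cyclotomic unit `x + x⁻¹`. -/
noncomputable def cosCyc (p : ℕ) : ℤ[ZMod p] := cyc 1 + cyc (-1)

@[simp] theorem conjInv_cosCyc : conjInv (cosCyc p) = cosCyc p := by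
  simp [cosCyc, add_comm]

@[simp] theorem aug_cosCyc : aug (cosCyc p) = 2 := by
  simp [cosCyc]

theorem cycNorm_cosCyc (hp : p ≠ 2) : cycNorm (cosCyc p) = 1 := by
  have h : cosCyc p = cyc (-1) * dilate 2 (cyc 1 + 1) := by
    simp only [map_add, dilate_cyc, map_one, mul_add, cyc_mul, cosCyc, mul_one]
    norm_num
  rw [h, cycNorm_mul, cycNorm_cyc hp, cycNorm_dilate (zmod_two_ne_zero hp),
    cycNorm_cyc_one_add_one hp, one_mul]

theorem cycNorm_two_sub_cosCyc (hp : p ≠ 2) : cycNorm (2 - cosCyc p) = p ^ 2 := by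
  have h : 2 - cosCyc p = (cyc 1 - 1) * conjInv (cyc 1 - 1) := by
    have h2 : cyc (1 : ZMod p) * cyc (-1) = 1 := by rw [cyc_mul, add_neg_cancel, cyc_zero]
    simp only [map_sub, map_one, conjInv_cyc, cosCyc]
    linear_combination -h2
  rw [h, cycNorm_mul, cycNorm_conjInv, cycNorm_cyc_one_sub_one hp, sq]

/-- Take `P` a unit of augmentation `1` and `Q` a lift of `(1 - x) (1 - x⁻¹)` of augmentation `t p`;
the resulting norm is `p ^ 2 * t p`. -/
theorem prime_pow_three_mul_mem (hp : p ≠ 2) {t : ℤ} (ht : Odd t) :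
    (p : ℤ) ^ 3 * t ∈ dicyclicDeterminants p := by
  have hpo : Odd (p : ℤ) := by exact_mod_cast (Fact.out : p.Prime).odd_of_ne_two hp
  have key {t : ℤ} (ht : 4 ∣ t * p - 1) : (p : ℤ) ^ 3 * t ∈ dicyclicDeterminants p := by
    obtain ⟨P, hP, hP1, hPa, ⟨w, hw⟩⟩ := exists_unit_aug_eq hp (E := cosCyc p) (n := 1) (s := 1)
      (by simp) (cycNorm_cosCyc hp) (by simpa using prime_not_dvd_two hp) not_dvd_one (by simp)
    obtain ⟨j, rfl⟩ : Odd t := by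
      by_contra h
      obtain ⟨i, rfl⟩ := (Int.not_odd_iff_even.1 h).two_dvd
      rw [mul_assoc] at ht
      omega
    let Q : ℤ[ZMod p] := 2 - cosCyc p + ((2 * j + 1 : ℤ) : ℤ[ZMod p]) * sumCyc p
    have hQa : aug Q = (2 * j + 1) * p := by
      simp only [Q, map_add, map_sub, map_mul, aug_two, map_intCast, aug_cosCyc, aug_sumCyc]
      simp
    have hQ1 : cycNorm Q = p ^ 2 := by
      rw [cycNorm_add_mul_sumCyc, cycNorm_two_sub_cosCyc hp]
    have hY : P - Q = 2 * (w + cosCyc p - 1 - j * sumCyc p) := by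
      simp only [Q]
      push_cast at hw ⊢
      linear_combination hw
    have hYa := congrArg aug hY
    rw [map_sub, map_mul, aug_two, hPa, hQa] at hYa
    have := mem_of_symmetric hp (P := P) (Q := Q) (G := 0) (f' := P) (g' := 0) hP
      (by simp [Q]) (by simp) hY (by rw [map_zero]; omega) (by simp) (by simp)
    simp only [hPa, hP1, hQ1, hQa, hP, mul_zero, add_zero, map_mul, cycNorm_mul, map_zero] at this
    convert this using 1
    ring
  have h1 := Int.odd_iff.1 (ht.mul hpo)
  rcases (by omega : 4 ∣ t * p - 1 ∨ 4 ∣ -(t * p) - 1) with h | h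
  · exact key h
  · have := neg_mem_dicyclicDeterminants hp (key (t := -t) (by rwa [neg_mul]))
    rwa [mul_neg, neg_neg] at this

/-- Take `P`, `Q` units of augmentations `2 a`, `2 b` congruent to `f' = x + x⁻¹` modulo `2`, and
`g' = 0`. -/
theorem sixteen_mul_mem (hp : p ≠ 2) {a b : ℤ} (ha : ¬ (p : ℤ) ∣ a) (hb : ¬ (p : ℤ) ∣ b)
    (hab : 2 ∣ a - b) : 2 ^ 4 * (a * b) ∈ dicyclicDeterminants p := by
  obtain ⟨P, hP, hP1, hPa, ⟨w, hw⟩⟩ := exists_unit_aug_eq hp (E := cosCyc p) (n := 2 * a) (s := 0)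
    (by simp) (cycNorm_cosCyc hp) (by simpa using prime_not_dvd_two hp) (not_dvd_two_mul hp ha)
    (by simp)
  obtain ⟨Q, hQ, hQ1, hQa, ⟨v, hv⟩⟩ := exists_unit_aug_eq hp (E := cosCyc p) (n := 2 * b) (s := 0)
    (by simp) (cycNorm_cosCyc hp) (by simpa using prime_not_dvd_two hp) (not_dvd_two_mul hp hb)
    (by simp)
  push_cast at hw hv
  have hY : P - Q = 2 * (w - v) := by linear_combination hw - hv
  have hYa := congrArg aug hY
  rw [map_sub, map_mul, aug_two, hPa, hQa] at hYa
  have := mem_of_symmetric hp (G := 0) (f' := cosCyc p) (g' := 0) hP hQ (by simp) hY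
    (by rw [map_zero]; omega) ⟨w, by linear_combination hw⟩ (by simp)
  simp only [hPa, hP1, hQa, hQ1, mul_zero, add_zero, map_mul, cycNorm_mul, conjInv_cosCyc,
    cycNorm_cosCyc hp, aug_cosCyc, map_zero] at this
  convert this using 1
  ring

/-- The elements `P` and `Q` are symmetric cyclotomic units of augmentations `2 a` and `2 b`,
congruent to `E + s Φ` modulo `2`, for `Φ` the sum of `C_p`. -/
theorem four_mul_mem (hp : p ≠ 2) {E G f' g' : ℤ[ZMod p]} (hE : conjInv E = E)
    (hE1 : cycNorm E = 1) (hEp : ¬ (p : ℤ) ∣ aug E) (s : ℤ) (hG : conjInv G = G)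
    (hEs : 2 ∣ aug E + s) (hGo : Odd (aug G)) (hf : 2 ∣ E + s * sumCyc p - G - f')
    (hg : 2 ∣ G - g') {a b : ℤ} (ha : ¬ (p : ℤ) ∣ a) (hb : ¬ (p : ℤ) ∣ b) (hab : Odd (a + b)) :
    4 * (a * b) * (aug (f' * conjInv f' + g' * conjInv g') *
      cycNorm (f' * conjInv f' + g' * conjInv g')) ∈ dicyclicDeterminants p := by
  obtain ⟨P, hP, hP1, hPa, ⟨w, hw⟩⟩ := exists_unit_aug_eq hp (n := 2 * a) (s := s) hE hE1 hEp
    (not_dvd_two_mul hp ha) (by omega)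
  obtain ⟨Q, hQ, hQ1, hQa, ⟨v, hv⟩⟩ := exists_unit_aug_eq hp (n := 2 * b) (s := s) hE hE1 hEp
    (not_dvd_two_mul hp hb) (by omega)
  have hY : P - Q = 2 * (w - v) := by linear_combination hw - hv
  have hYa := congrArg aug hY
  rw [map_sub, map_mul, aug_two, hPa, hQa] at hYa
  obtain ⟨u, hu⟩ := hf
  have h1 := Int.odd_iff.1 hab
  have h2 := Int.odd_iff.1 hGo
  have := mem_of_symmetric hp (f' := f') hP hQ hG hY (by omega)
    ⟨w + u, by linear_combination hw + hu⟩ hg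
  simp only [hPa, hP1, hQa, hQ1] at this
  convert this using 1
  ring

/-- Take `E = 1`, `f' = 1` and `g'` the sum of `C_p`: then `f' f̄' + g' ḡ'` has augmentation `1 + p
^ 2` and the value `1` at the nontrivial characters. -/
theorem sq_add_one_mem (hp : p ≠ 2) : 2 ^ 4 * ((p : ℤ) ^ 2 + 1) ∈ dicyclicDeterminants p := by
  have hpo : Odd (p : ℤ) := by exact_mod_cast (Fact.out : p.Prime).odd_of_ne_two hp
  have h4 : ¬ (p : ℤ) ∣ 4 := by
    rw [show (4 : ℤ) = 2 * 2 by norm_num]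
    exact not_dvd_two_mul hp (prime_not_dvd_two hp)
  have := four_mul_mem hp (E := 1) (G := sumCyc p) (f' := 1) (g' := sumCyc p) (a := 4) (b := 1)
    (by simp) (by simp) (by simpa using not_dvd_one) 1 (by simp) (by simp) (by simpa using hpo)
    (by simp) (by simp) h4 not_dvd_one (by decide)
  rw [conjInv_sumCyc, map_one, cycNorm_add_mul_sumCyc] at this
  simp only [map_add, map_mul, map_one, aug_sumCyc, mul_one, cycNorm_one] at this
  convert this using 1
  ring

theorem cycNorm_cyc_one_sub_cyc_neg_one (hp : p ≠ 2) :
    cycNorm (cyc (1 : ZMod p) - cyc (-1)) = p := by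
  have h : cyc (1 : ZMod p) - cyc (-1) = cyc (-1) * dilate 2 (cyc 1 - 1) := by
    simp only [map_sub, dilate_cyc, map_one, mul_sub, cyc_mul, mul_one]
    norm_num
  rw [h, cycNorm_mul, cycNorm_cyc hp, cycNorm_dilate (zmod_two_ne_zero hp),
    cycNorm_cyc_one_sub_one hp, one_mul]

/-- Take `f' = x - x⁻¹ + t Φ` and `g' = t' Φ`, for `Φ` the sum of `C_p`: the augmentation
contributes `p ^ 2 (t ^ 2 + t' ^ 2)` and the nontrivial characters contribute `p ^ 2`. -/
theorem prime_pow_four_mul_mem (hp : p ≠ 2) {t t' m : ℤ} (ht : Odd t) (ht' : Odd t')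
    (hm : ¬ (p : ℤ) ∣ m) :
    2 ^ 4 * (p : ℤ) ^ 4 * (t ^ 2 + t' ^ 2) * m ∈ dicyclicDeterminants p := by
  have hpo : Odd (p : ℤ) := by exact_mod_cast (Fact.out : p.Prime).odd_of_ne_two hp
  have h4 : ¬ (p : ℤ) ∣ 4 * m := by
    rw [show (4 : ℤ) * m = 2 * (2 * m) by ring]
    exact not_dvd_two_mul hp (not_dvd_two_mul hp hm)
  obtain ⟨i, rfl⟩ := ht
  obtain ⟨j, rfl⟩ := ht'
  set f' : ℤ[ZMod p] := cyc 1 - cyc (-1) + ((2 * i + 1 : ℤ) : ℤ[ZMod p]) * sumCyc p with hf'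
  set g' : ℤ[ZMod p] := ((2 * j + 1 : ℤ) : ℤ[ZMod p]) * sumCyc p with hg'
  have := four_mul_mem hp (E := cosCyc p) (G := sumCyc p) (f' := f') (g' := g')
    (a := 4 * m) (b := 1)
    (by simp) (cycNorm_cosCyc hp) (by simpa using prime_not_dvd_two hp) 0 (by simp) (by simp)
    (by simpa using hpo) ⟨cyc (-1) - ((i : ℤ[ZMod p]) + 1) * sumCyc p, by
      rw [hf', cosCyc]; push_cast; ring⟩
    ⟨-(j : ℤ[ZMod p]) * sumCyc p, by rw [hg']; push_cast; ring⟩ h4 not_dvd_one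
    (Int.odd_iff.2 (by omega))
  have ha : aug (f' * conjInv f' + g' * conjInv g') =
      p ^ 2 * ((2 * i + 1) ^ 2 + (2 * j + 1) ^ 2) := by
    simp only [map_add, map_mul, aug_conjInv, hf', hg', map_sub, aug_cyc, map_intCast, aug_sumCyc]
    simp
    ring
  have hn : cycNorm (f' * conjInv f' + g' * conjInv g') = p ^ 2 := by
    have h : cycNorm (f' * conjInv f' + g' * conjInv g') =
        cycNorm ((cyc 1 - cyc (-1)) * conjInv (cyc 1 - cyc (-1))) :=
      cycNorm_congr fun k hk => by simp [hf', hg', evalZeta_sumCyc hk]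
    rw [h, cycNorm_mul, cycNorm_conjInv, cycNorm_cyc_one_sub_cyc_neg_one hp, sq]
  rw [ha, hn] at this
  convert this using 1
  ring

/-- For `p = 5` the value of `(x + x⁻¹)² + 1` at a primitive character is that of `(1 - x) (1 -
x⁻¹)`, of norm `p ^ 2`, while the augmentation of `(x + x⁻¹ - Φ)² + 1` is `10`. -/
theorem two_pow_five_mul_five_pow_three_mem [Fact (Nat.Prime 5)] {m : ℤ} (hm : ¬ (5 : ℤ) ∣ m) :
    2 ^ 5 * (5 : ℤ) ^ 3 * m ∈ dicyclicDeterminants 5 := by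
  have h5 : (5 : ℕ) ≠ 2 := by norm_num
  have hz : (5 : ZMod 5) = 0 := by exact_mod_cast ZMod.natCast_self 5
  have hE : geomCyc 5 1 1 = 1 + cosCyc 5 := by
    simp only [geomCyc, Finset.sum_range_succ, Finset.sum_range_zero, cosCyc, Int.cast_one, one_mul,
      mul_add, mul_one, cyc_pow, cyc_mul, zero_add]
    rw [Nat.cast_zero, Nat.cast_one, add_zero, neg_add_cancel, cyc_zero,
      show (-1 + ((2 : ℕ) : ZMod 5)) = 1 by push_cast; ring]
    ring
  -- At a primitive fifth root of unity, `x + x⁻¹` is a root of `X ^ 2 + X - 1`.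
  have hcos : cosCyc 5 * cosCyc 5 + 1 = 2 - cosCyc 5 + sumCyc 5 := by
    have hsum : sumCyc 5 = cyc 0 + cyc 1 + cyc 2 + cyc 3 + cyc 4 :=
      Fin.sum_univ_five (fun i : Fin 5 => cyc (p := 5) i)
    simp only [hsum, cosCyc, mul_add, add_mul, cyc_mul]
    rw [neg_add_cancel, add_neg_cancel, one_add_one_eq_two,
      show (-1 + -1 : ZMod 5) = 3 by linear_combination -hz,
      show (-1 : ZMod 5) = 4 by linear_combination -hz, cyc_zero]
    ring
  have h4 : ¬ ((5 : ℕ) : ℤ) ∣ 4 * m := by push_cast; omega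
  have h3 : (2 * ((1 : ℕ) : ZMod 5) + 1) ≠ 0 := by
    have : ((3 : ℕ) : ZMod 5) ≠ 0 := by
      rw [Ne, ZMod.natCast_eq_zero_iff]
      norm_num
    intro h
    apply this
    push_cast at h ⊢
    linear_combination h
  have := four_mul_mem h5 (E := geomCyc 5 1 1) (G := 1) (f' := -cosCyc 5 + sumCyc 5) (g' := 1)
    (a := 4 * m) (b := 1) (conjInv_geomCyc (by norm_num) 1)
    (cycNorm_geomCyc h5 (.inl rfl) h3) (by rw [aug_geomCyc_one]; norm_num) 1 (by simp)
    (by rw [aug_geomCyc_one]; norm_num) (by simp)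
    ⟨cosCyc 5, by rw [hE]; push_cast; ring⟩ (by simp) h4 (by norm_num) (Int.odd_iff.2 (by omega))
  have hn : cycNorm ((-cosCyc 5 + sumCyc 5) * conjInv (-cosCyc 5 + sumCyc 5) + 1 * conjInv 1) =
      5 ^ 2 := by
    have h : cycNorm ((-cosCyc 5 + sumCyc 5) * conjInv (-cosCyc 5 + sumCyc 5) + 1 * conjInv 1) =
        cycNorm (2 - cosCyc 5 + 1 * sumCyc 5) :=
      cycNorm_congr fun k hk => by
        rw [show 2 - cosCyc 5 + 1 * sumCyc 5 = cosCyc 5 * cosCyc 5 + 1 by rw [hcos, one_mul]]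
        simp [evalZeta_sumCyc hk]
    rw [h, cycNorm_add_mul_sumCyc, cycNorm_two_sub_cosCyc h5]
    rfl
  rw [hn] at this
  simp only [map_add, map_mul, map_neg, aug_conjInv, aug_cosCyc, aug_sumCyc, map_one] at this
  convert this using 1
  push_cast
  ring

end Constructions

/-! ### The values of the determinant -/

section Assembly
variable {p : ℕ} [Fact p.Prime]

theorem prime_pow_mem (hp : p ≠ 2) {l : ℕ} (hl : l = 0 ∨ 3 ≤ l) :
    (p : ℤ) ^ l ∈ dicyclicDeterminants p := by
  have hpo : Odd (p : ℤ) := by exact_mod_cast (Fact.out : p.Prime).odd_of_ne_two hp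
  rcases hl with rfl | hl
  · rw [pow_zero]
    exact mem_of_odd_of_not_dvd hp odd_one not_dvd_one
  · obtain ⟨j, rfl⟩ := Nat.exists_eq_add_of_le hl
    rw [pow_add]
    exact prime_pow_three_mul_mem hp hpo.pow

theorem two_pow_mul_prime_pow_mul_mem (hp : p ≠ 2) {k l : ℕ} {m : ℤ}
    (hm : Int.gcd m (2 * p) = 1) (hk : k = 0 ∨ k = 4 ∨ 6 ≤ k) (hl : l = 0 ∨ 3 ≤ l) :
    2 ^ k * (p : ℤ) ^ l * m ∈ dicyclicDeterminants p := by
  obtain ⟨hmo, hmp⟩ := odd_and_not_dvd_of_gcd hm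
  have h : 2 ^ k * m ∈ dicyclicDeterminants p := by
    rcases hk with rfl | rfl | hk
    · rw [pow_zero, one_mul]
      exact mem_of_odd_of_not_dvd hp hmo hmp
    · have := Int.odd_iff.1 hmo
      simpa using sixteen_mul_mem hp not_dvd_one hmp (by omega)
    · obtain ⟨j, rfl⟩ := Nat.exists_eq_add_of_le hk
      have hpr : Prime (p : ℤ) := Nat.prime_iff_prime_int.1 Fact.out
      have hb : ¬ (p : ℤ) ∣ 2 * (2 ^ j * m) := not_dvd_two_mul hp fun h =>
        (hpr.dvd_or_dvd h).elim (fun h => prime_not_dvd_two hp (hpr.dvd_of_dvd_pow h)) hmp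
      have := sixteen_mul_mem hp (prime_not_dvd_two hp) hb (by omega)
      convert this using 1
      ring
  have := mul_mem_dicyclicDeterminants (prime_pow_mem hp hl) h
  convert this using 1
  ring

theorem two_pow_five_mul_prime_pow_mul_mem (hp : p ≠ 2) {l : ℕ} {m : ℤ}
    (hm : ¬ (p : ℤ) ∣ m) (hl : l = 4 ∨ 6 ≤ l) :
    2 ^ 5 * (p : ℤ) ^ l * m ∈ dicyclicDeterminants p := by
  have hpo : Odd (p : ℤ) := by exact_mod_cast (Fact.out : p.Prime).odd_of_ne_two hp
  have h4 : 2 ^ 5 * (p : ℤ) ^ 4 * m ∈ dicyclicDeterminants p := by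
    convert prime_pow_four_mul_mem hp odd_one odd_one hm using 1
    ring
  rcases (by omega : l = 4 ∨ l = 6 ∨ 7 ≤ l) with rfl | rfl | hl
  · exact h4
  · convert prime_pow_four_mul_mem hp hpo hpo hm using 1
    ring
  · obtain ⟨j, rfl⟩ := Nat.exists_eq_add_of_le hl
    convert mul_mem_dicyclicDeterminants h4
      (prime_pow_mem hp (l := 3 + j) (.inr (by omega))) using 1
    ring

theorem two_pow_five_mul_prime_pow_five_mul_mem (hp : p ≠ 2) (hp4 : p % 4 = 1) {m : ℤ}
    (hm : ¬ (p : ℤ) ∣ m) : 2 ^ 5 * (p : ℤ) ^ 5 * m ∈ dicyclicDeterminants p := by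
  obtain ⟨a, b, hab⟩ := Nat.Prime.sq_add_sq (p := p) (by omega)
  have hab' : (a : ℤ) ^ 2 + b ^ 2 = p := by exact_mod_cast hab
  have hpo : Odd (p : ℤ) := by exact_mod_cast (Fact.out : p.Prime).odd_of_ne_two hp
  have h1 : Odd ((a : ℤ) + b) := by
    rw [← hab'] at hpo
    simpa [parity_simps] using hpo
  have h2 : Odd ((a : ℤ) - b) := by
    rw [← hab'] at hpo
    simpa [parity_simps] using hpo
  -- `2 p` is the sum of two odd squares.
  convert prime_pow_four_mul_mem hp h1 h2 hm using 1
  rw [← hab']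
  ring

theorem zero_mem_dicyclicDeterminants (hp : p ≠ 2) : 0 ∈ dicyclicDeterminants p :=
  (mem_dicyclicDeterminants_iff hp).2 ⟨0, 0, 0, 0, by simp, by simp, by simp⟩

/-- Only the exponent `5` of `2` and small exponents of `p` need a separate argument. -/
theorem mem_of_two_pow_five_mul_dvd (hp : p ≠ 2) {j : ℕ} (hj : 3 ≤ j)
    (h : ∀ (l : ℕ) (m : ℤ), ¬ (p : ℤ) ∣ m → j ≤ l → l < 6 →
      2 ^ 5 * (p : ℤ) ^ l * m ∈ dicyclicDeterminants p)
    {d : ℤ} (hd : 2 ^ 5 * (p : ℤ) ^ j ∣ d) : d ∈ dicyclicDeterminants p := by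
  rcases eq_or_ne d 0 with rfl | h0
  · exact zero_mem_dicyclicDeterminants hp
  obtain ⟨k, l, m, rfl, hm⟩ := exists_eq_two_pow_mul (p := p) h0
  obtain ⟨hmo, hmp⟩ := odd_and_not_dvd_of_gcd hm
  have hpr : Prime (p : ℤ) := Nat.prime_iff_prime_int.1 Fact.out
  have hpo : Odd (p : ℤ) := by exact_mod_cast (Fact.out : p.Prime).odd_of_ne_two hp
  have hk : 5 ≤ k := by
    have h2 := (Dvd.intro _ rfl).trans hd
    rw [mul_assoc] at h2
    have hcop : IsCoprime ((2 : ℤ) ^ 5) (p ^ l * m) :=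
      (Int.isCoprime_two_left.2 (hpo.pow.mul hmo)).pow_left
    exact (pow_dvd_pow_iff two_ne_zero Int.prime_two.not_isUnit).1 (hcop.dvd_of_dvd_mul_right h2)
  have hl : j ≤ l := by
    have h2 := (Dvd.intro_left _ rfl).trans hd
    rw [mul_right_comm] at h2
    have hcop : IsCoprime ((p : ℤ) ^ j) (2 ^ k * m) :=
      ((hpr.coprime_iff_not_dvd).2 fun h => (hpr.dvd_or_dvd h).elim
        (fun h => prime_not_dvd_two hp (hpr.dvd_of_dvd_pow h)) hmp).pow_left
    exact (pow_dvd_pow_iff hpr.ne_zero hpr.not_isUnit).1 (hcop.dvd_of_dvd_mul_left h2)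
  rcases hk.eq_or_lt with rfl | hk
  · rcases lt_or_ge l 6 with h6 | h6
    · exact h l m hmp hl h6
    · exact two_pow_five_mul_prime_pow_mul_mem hp hmp (.inr h6)
  · exact two_pow_mul_prime_pow_mul_mem hp hm (.inr (.inr hk)) (.inr (hj.trans hl))

theorem two_mul_half_sq_add_one (hp : p ≠ 2) :
    2 * (((p ^ 2 + 1) / 2 : ℕ) : ℤ) = (p : ℤ) ^ 2 + 1 := by
  have h := Nat.odd_iff.1 (((Fact.out : p.Prime).odd_of_ne_two hp).pow (n := 2))
  have : 2 * ((p ^ 2 + 1) / 2) = p ^ 2 + 1 := by omega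
  exact_mod_cast this

theorem gcd_half_sq_add_one (hp : p ≠ 2) :
    Int.gcd (((p ^ 2 + 1) / 2 : ℕ) : ℤ) (2 * p) = 1 := by
  have h := two_mul_half_sq_add_one hp
  have hpo : Odd (p : ℤ) := by exact_mod_cast (Fact.out : p.Prime).odd_of_ne_two hp
  have h8 := Int.eight_dvd_sq_sub_one_of_odd hpo
  have hpr : Prime (p : ℤ) := Nat.prime_iff_prime_int.1 Fact.out
  rw [← Int.isCoprime_iff_gcd_eq_one]
  refine IsCoprime.mul_right (Int.isCoprime_two_right.2 (Int.odd_iff.2 (by omega)))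
    ((hpr.coprime_iff_not_dvd).2 fun hd => hpr.not_dvd_one ?_).symm
  have h2 : (p : ℤ) ∣ p ^ 2 + 1 := by
    rw [← h]
    exact hd.mul_left _
  exact (Int.dvd_add_right (dvd_pow_self _ two_ne_zero)).1 h2

theorem half_sq_add_one_mem (hp : p ≠ 2) {l : ℕ} (hl : l = 0 ∨ 3 ≤ l) :
    2 ^ 5 * (p : ℤ) ^ l * (((p ^ 2 + 1) / 2 : ℕ) : ℤ) ∈ dicyclicDeterminants p := by
  convert mul_mem_dicyclicDeterminants (prime_pow_mem hp hl) (sq_add_one_mem hp) using 1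
  rw [← two_mul_half_sq_add_one hp]
  ring

theorem isLeast_cofactorAbsValues (hp : p ≠ 2) {l : ℕ}
    (hl : l = 0 ∨ (p % 4 = 3 ∧ (l = 3 ∨ l = 5))) :
    IsLeast (cofactorAbsValues p l) ((p ^ 2 + 1) / 2) := by
  refine ⟨⟨_, gcd_half_sq_add_one hp, half_sq_add_one_mem hp (by omega),
    (Int.natAbs_natCast _).symm⟩, ?_⟩
  rintro _ ⟨m, hm, hd, rfl⟩
  exact le_natAbs_of_mem hp hm hd hl

end Assembly

theorem theorem2 (p : ℕ) [Fact p.Prime] (hp : p ≠ 2) :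
    -- the form of the (nonzero) determinants
    (∀ d ∈ dicyclicDeterminants p, d ≠ 0 →
      ∃ (k l : ℕ) (m : ℤ), d = 2 ^ k * (p : ℤ) ^ l * m ∧ Int.gcd m (2 * p) = 1 ∧
        (k = 0 ∨ 4 ≤ k) ∧ (l = 0 ∨ 3 ≤ l)) ∧
    -- all such values with `k = 0`, `k = 4` or `k ≥ 6` are achieved
    (∀ (k l : ℕ) (m : ℤ), Int.gcd m (2 * p) = 1 → (k = 0 ∨ k = 4 ∨ 6 ≤ k) → (l = 0 ∨ 3 ≤ l) →
      2 ^ k * (p : ℤ) ^ l * m ∈ dicyclicDeterminants p) ∧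
    -- all such values with `k = 5` and `l = 4` or `l ≥ 6` are achieved
    (∀ (l : ℕ) (m : ℤ), Int.gcd m (2 * p) = 1 → (l = 4 ∨ 6 ≤ l) →
      2 ^ 5 * (p : ℤ) ^ l * m ∈ dicyclicDeterminants p) ∧
    -- not all `2 ^ 5 * m` are achieved
    (∃ m : ℤ, Int.gcd m (2 * p) = 1 ∧ 2 ^ 5 * m ∉ dicyclicDeterminants p) ∧
    -- the smallest `2 ^ 5 * |m|`
    (IsLeast (cofactorAbsValues p 0) ((p ^ 2 + 1) / 2) ∧
      2 ^ 5 * (((p ^ 2 + 1) / 2 : ℕ) : ℤ) ∈ dicyclicDeterminants p) ∧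
    -- the smallest `2 ^ 5 * p ^ 3 * |m|` and `2 ^ 5 * p ^ 5 * |m|` for `p ≡ 3` mod `4`
    (p % 4 = 3 → ∀ l : ℕ, l = 3 ∨ l = 5 →
      IsLeast (cofactorAbsValues p l) ((p ^ 2 + 1) / 2) ∧
      2 ^ 5 * (p : ℤ) ^ l * (((p ^ 2 + 1) / 2 : ℕ) : ℤ) ∈ dicyclicDeterminants p) ∧
    -- all multiples of `2 ^ 5 * p ^ 5` for `p ≡ 1` mod `4`
    (p % 4 = 1 → ∀ d : ℤ, 2 ^ 5 * (p : ℤ) ^ 5 ∣ d → d ∈ dicyclicDeterminants p) ∧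
    -- all multiples of `2 ^ 5 * p ^ 3` for `p = 5`
    (p = 5 → ∀ d : ℤ, 2 ^ 5 * (p : ℤ) ^ 3 ∣ d → d ∈ dicyclicDeterminants p) := by
  have hp3 : 3 ≤ p := by
    have := (Fact.out : p.Prime).two_le
    omega
  refine ⟨fun d hd h0 => form_of_mem hp hd h0, fun k l m hm hk hl =>
      two_pow_mul_prime_pow_mul_mem hp hm hk hl, fun l m hm hl =>
      two_pow_five_mul_prime_pow_mul_mem hp (odd_and_not_dvd_of_gcd hm).2 hl, ⟨1, by simp, ?_⟩,
    ⟨isLeast_cofactorAbsValues hp (.inl rfl), ?_⟩, fun hp4 l hl =>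
      ⟨isLeast_cofactorAbsValues hp (.inr ⟨hp4, hl⟩), half_sq_add_one_mem hp (by omega)⟩,
    fun hp4 d hd => ?_, ?_⟩
  · intro h
    have := le_natAbs_of_mem hp (l := 0) (m := 1) (by simp) (by simpa using h) (.inl rfl)
    have h9 : 3 ^ 2 ≤ p ^ 2 := Nat.pow_le_pow_left hp3 2
    simp only [Int.natAbs_one] at this
    omega
  · simpa using half_sq_add_one_mem hp (.inl rfl)
  · refine mem_of_two_pow_five_mul_dvd hp (by norm_num) (fun l m hm h5 h6 => ?_) hd
    obtain rfl : l = 5 := by omega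
    exact two_pow_five_mul_prime_pow_five_mul_mem hp hp4 hm
  · rintro rfl d hd
    refine mem_of_two_pow_five_mul_dvd hp le_rfl (fun l m hm h3 h6 => ?_) hd
    rcases (by omega : l = 3 ∨ l = 4 ∨ l = 5) with rfl | rfl | rfl
    · exact two_pow_five_mul_five_pow_three_mem hm
    · exact two_pow_five_mul_prime_pow_mul_mem hp hm (.inl rfl)
    · exact two_pow_five_mul_prime_pow_five_mul_mem hp (by norm_num) hm
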